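/- Call $\nu$ a simple point measure on $[0,1]$ if it is a finite sum of unit point masses at distinct points, and equip the set $\mathbb M$ of simple point measures on $[0,1]$ with the $\sigma$-algebra generated by the maps $\nu\mapsto\nu(A)$, $A\subseteq[0,1]$ Borel. For $r>0$, a homogeneous Poisson process of intensity $r$ on $[0,1]$ is a random element $\Pi$ of $\mathbb M$ such that $\Pi(A)$ is Poisson with mean $r$ times the Lebesgue measure of $A$ for every Borel $A\subseteq[0,1]$, and $\Pi(A_1),\dots,\Pi(A_m)$ are independent whenever $A_1,\dots,A_m$ are pairwise disjoint Borel sets. For $\lambda>\mu>0$, a (deterministic, Poisson) thinning on $[0,1]$ from $\lambda$ to $\mu$ is a measurable function $f:\mathbb M\to\mathbb M$ such that, if $\Pi$ is a homogeneous Poisson process of intensity $\lambda$ on $[0,1]$, then $f(\Pi)$ is a homogeneous Poisson process of intensity $\mu$ on $[0,1]$ and almost surely every point of $f(\Pi)$ is a point of $\Pi$. **Corollary (Monotonicity in $\lambda$).** Let $\lambda>\mu>0$ and suppose that there is a thinning on $[0,1]$ from $\lambda$ to $\mu$. (i) If $\lambda'>\lambda$, then there exists a thinning on $[0,1]$ from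 $\lambda'$ to $\mu$. (ii) If $\mu'/\lambda'=\mu/\lambda$ and $\lambda'>\lambda$, then there exists a thinning on $[0,1]$ from $\lambda'$ to $\mu'$. -/

import Mathlib

open MeasureTheory ProbabilityTheory
open scoped NNReal ENNReal unitInterval

/-- The space of simple point measures on `[0,1]`: finite sums of unit point masses
at distinct points. -/
def SimplePointMeasure : Type :=
  {ν : Measure I // ∃ s : Finset I, ν = ∑ x ∈ s, Measure.dirac x}

namespace SimplePointMeasure

/-- The trace of the usual `σ`-algebra on measures, which is generated by the evaluation maps
`ν ↦ ν A`, for `A` Borel. -/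
instance : MeasurableSpace SimplePointMeasure :=
  inferInstanceAs (MeasurableSpace
    {ν : Measure I // ∃ s : Finset I, ν = ∑ x ∈ s, Measure.dirac x})

/-- The underlying measure on `[0,1]`. -/
def toMeasure (ν : SimplePointMeasure) : Measure I := ν.1

/-- The set of points (the support) of a simple point measure. -/
def points (ν : SimplePointMeasure) : Set I := {x | ν.toMeasure {x} = 1}

end SimplePointMeasure

/-- Under the probability measure `P`, the random simple point measure `Z` is a homogeneous Poisson
point process on `[0,1]` with intensity `r`: the number of points in each Borel set `A` is
Poisson with mean `r` times the Lebesgue measure of `A`, and the numbers of points in finitely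
many pairwise disjoint Borel sets are independent. -/
structure IsPoissonProcess {Ω : Type*} [MeasurableSpace Ω] (r : ℝ≥0)
    (Z : Ω → SimplePointMeasure) (P : Measure Ω) : Prop where
  measurable : Measurable Z
  count_law : ∀ A : Set I, MeasurableSet A → ∀ n : ℕ,
    P {ω | (Z ω).toMeasure A = n} = poissonMeasure (r * (volume A).toNNReal) {n}
  indep : ∀ (m : ℕ) (A : Fin m → Set I), (∀ i, MeasurableSet (A i)) →
    Pairwise (fun i j => Disjoint (A i) (A j)) →
    iIndepFun (fun i ω => (Z ω).toMeasure (A i)) P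

/-- `f` is a (deterministic, Poisson) thinning on `[0,1]` from `lam` to `mu`: `f` is a measurable
map of simple point measures, and if `Z` is a homogeneous Poisson process of intensity `lam`,
then `f(Z)` is a homogeneous Poisson process of intensity `mu`, all of whose points are almost
surely points of `Z`. -/
structure IsThinning (lam mu : ℝ≥0) (f : SimplePointMeasure → SimplePointMeasure) : Prop where
  measurable : Measurable f
  isPoissonProcess : ∀ (Ω : Type) [MeasurableSpace Ω] (P : Measure Ω) [IsProbabilityMeasure P]
    (Z : Ω → SimplePointMeasure), IsPoissonProcess lam Z P →
      IsPoissonProcess mu (fun ω => f (Z ω)) P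
  points_subset : ∀ (Ω : Type) [MeasurableSpace Ω] (P : Measure Ω) [IsProbabilityMeasure P]
    (Z : Ω → SimplePointMeasure), IsPoissonProcess lam Z P →
      ∀ᵐ ω ∂P, (f (Z ω)).points ⊆ (Z ω).points

/-! Write `π_r(n)` for the Poisson weight and `F_r(n)` for the distribution function. Given its
number of points, a Poisson process consists of independent uniform points. A thinning is shown to
force the condition: `π_μ(n+1) < π_λ(n+1)` implies `F_λ(n+1) ≤ F_μ(n)`. This condition also suffices
when `0 < μ < λ`, and it survives both changes of intensity.

Necessity (`IsThinning.ae_ne`, `IsThinning.poissonCDF_le`): let `B` be the set of `n`-point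
configurations left unchanged. Its mass under intensity `λ` is at most its mass under `μ`, so if
`π_μ(n) < π_λ(n)` then `B` is null. Hence at most `n+1` initial points leave at most `n`, which
compares the distribution functions.

Transfer: since `∂F_r(n)/∂r = -π_r(n)`, the condition says that the likelihood ratio
`π_r(n+1)/π_μ(n+1)`, integrated over `r` from `μ` to `λ`, is at least 1 whenever its value at `r =
λ` exceeds 1. `ThinningCondition.mono` and `ThinningCondition.scale` are then calculus.

Sufficiency (`lintegral_mark_remove`, `map_thin_poissonLaw`): from `n+1` uniform points one can be
removed deterministically so that `n` uniform points remain, together with an independent uniform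
mark read off from the removed point. For a threshold `k`, configurations of at most `k` points are
kept whole. Otherwise the mark supplies the randomness for choosing how many points to keep, through
a quantile coupling with the part of the law `π_μ` not yet used; the inequality between distribution
functions ensures that the chosen number is available. -/

/-! ### Configurations as finite sets of points -/

namespace SimplePointMeasure

/-- The finite set of points of a simple point measure. -/
noncomputable def pts (ν : SimplePointMeasure) : Finset I := ν.2.choose

/-- The simple point measure with a given finite set of points. -/
noncomputable def ofFinset (s : Finset I) : SimplePointMeasure :=
  ⟨∑ x ∈ s, Measure.dirac x, s, rfl⟩

lemma toMeasure_eq (ν : SimplePointMeasure) : ν.toMeasure = ∑ x ∈ ν.pts, Measure.dirac x :=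
  ν.2.choose_spec

lemma toMeasure_ofFinset (s : Finset I) :
    (ofFinset s).toMeasure = ∑ x ∈ s, Measure.dirac x := rfl

lemma toMeasure_injective : Function.Injective toMeasure := Subtype.val_injective

lemma measurable_toMeasure : Measurable toMeasure := measurable_subtype_coe

lemma measurable_eval {A : Set I} (hA : MeasurableSet A) :
    Measurable fun ν : SimplePointMeasure => ν.toMeasure A :=
  (Measure.measurable_coe hA).comp measurable_toMeasure

lemma measurable_of_eval {α : Type*} [MeasurableSpace α] {f : α → SimplePointMeasure}
    (h : ∀ A : Set I, MeasurableSet A → Measurable fun a => (f a).toMeasure A) : Measurable f :=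
  Measurable.subtype_mk (Measure.measurable_of_measurable_coe _ h)

open scoped Classical in
lemma sum_dirac_apply (s : Finset I) (A : Set I) :
    (∑ x ∈ s, Measure.dirac x) A = ((s.filter (· ∈ A)).card : ℝ≥0∞) := by
  simp [Measure.finsetSum_apply, Measure.dirac_apply, Set.indicator_apply]

open scoped Classical in
lemma toMeasure_apply (ν : SimplePointMeasure) (A : Set I) :
    ν.toMeasure A = ((ν.pts.filter (· ∈ A)).card : ℝ≥0∞) := by
  rw [toMeasure_eq, sum_dirac_apply]

lemma toMeasure_univ (ν : SimplePointMeasure) : ν.toMeasure Set.univ = (ν.pts.card : ℝ≥0∞) := by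
  simp [toMeasure_apply]

lemma ofFinset_pts (ν : SimplePointMeasure) : ofFinset ν.pts = ν :=
  toMeasure_injective (toMeasure_eq ν).symm

lemma mem_pts_iff (ν : SimplePointMeasure) (x : I) : x ∈ ν.pts ↔ ν.toMeasure {x} = 1 := by
  rw [toMeasure_apply]
  by_cases h : x ∈ ν.pts
  · simp [Finset.filter_eq', h]
  · simp [Finset.filter_eq', h]

lemma coe_pts (ν : SimplePointMeasure) : (ν.pts : Set I) = ν.points := by
  ext x; exact mem_pts_iff ν x

@[simp] lemma pts_ofFinset (s : Finset I) : (ofFinset s).pts = s := by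
  ext x
  rw [mem_pts_iff, toMeasure_ofFinset, sum_dirac_apply]
  by_cases h : x ∈ s
  · simp [Finset.filter_eq', h]
  · simp [Finset.filter_eq', h]

lemma pts_injective : Function.Injective pts := fun a b h => by
  rw [← ofFinset_pts a, h, ofFinset_pts]

instance (ν : SimplePointMeasure) : IsFiniteMeasure ν.toMeasure :=
  ⟨by simp [toMeasure_univ]⟩

lemma lintegral_toMeasure (ν : SimplePointMeasure) (g : I → ℝ≥0∞) :
    ∫⁻ x, g x ∂ν.toMeasure = ∑ x ∈ ν.pts, g x := by
  rw [toMeasure_eq, lintegral_finsetSum_measure]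
  simp

/-- The event that there are exactly `n` points. -/
def cardSet (n : ℕ) : Set SimplePointMeasure := {ν | ν.pts.card = n}

lemma measurable_card : Measurable fun ν : SimplePointMeasure => ν.pts.card := by
  refine measurable_to_countable' fun n => ?_
  have : (fun ν : SimplePointMeasure => ν.pts.card) ⁻¹' {n} =
      (fun ν : SimplePointMeasure => ν.toMeasure Set.univ) ⁻¹' {(n : ℝ≥0∞)} := by
    ext ν; simp [toMeasure_univ]
  rw [this]
  exact measurable_eval .univ (measurableSet_singleton _)

lemma measurableSet_cardSet (n : ℕ) : MeasurableSet (cardSet n) :=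
  measurable_card (measurableSet_singleton n)

open scoped Classical in
/-- The simple point measure carried by a tuple of distinct points (and `0` for other tuples). -/
noncomputable def conf {n : ℕ} (x : Fin n → I) : SimplePointMeasure :=
  if Function.Injective x then ofFinset (Finset.univ.image x) else ofFinset ∅

open scoped Classical in
lemma conf_of_injective {n : ℕ} {x : Fin n → I} (hx : Function.Injective x) :
    conf x = ofFinset (Finset.univ.image x) := if_pos hx

open scoped Classical in
lemma pts_conf {n : ℕ} {x : Fin n → I} (hx : Function.Injective x) :
    (conf x).pts = Finset.univ.image x := by rw [conf_of_injective hx, pts_ofFinset]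

lemma card_conf {n : ℕ} {x : Fin n → I} (hx : Function.Injective x) :
    (conf x).pts.card = n := by
  classical
  rw [pts_conf hx, Finset.card_image_of_injective _ hx]; simp

lemma sum_pts_conf {M : Type*} [AddCommMonoid M] {n : ℕ} {x : Fin n → I}
    (hx : Function.Injective x) (g : I → M) : ∑ y ∈ (conf x).pts, g y = ∑ i, g (x i) := by
  classical
  rw [pts_conf hx, Finset.sum_image fun a _ b _ h => hx h]

lemma conf_apply {n : ℕ} {x : Fin n → I} (hx : Function.Injective x) (A : Set I) :
    (conf x).toMeasure A = ∑ i, A.indicator 1 (x i) := by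
  classical
  rw [toMeasure_eq, Measure.finsetSum_apply, sum_pts_conf hx]
  simp [Measure.dirac_apply]

lemma measurableSet_injective (n : ℕ) :
    MeasurableSet {x : Fin n → I | Function.Injective x} := by
  have : {x : Fin n → I | Function.Injective x} =
      ⋂ i, ⋂ j, {x : Fin n → I | x i = x j → i = j} := by
    ext x; simp [Function.Injective]
  rw [this]
  refine .iInter fun i => .iInter fun j => ?_
  by_cases h : i = j
  · simp [h]
  · simp only [h, imp_false]
    exact (measurableSet_eq_fun (measurable_pi_apply i) (measurable_pi_apply j)).compl

lemma measurable_conf (n : ℕ) : Measurable (conf : (Fin n → I) → SimplePointMeasure) := by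
  classical
  refine measurable_of_eval fun A hA => ?_
  have : (fun x : Fin n → I => (conf x).toMeasure A) = fun x =>
      if x ∈ {x : Fin n → I | Function.Injective x} then ∑ i, A.indicator 1 (x i) else 0 := by
    ext x
    by_cases h : Function.Injective x
    · simp [h, conf_apply]
    · simp [h, conf, toMeasure_ofFinset]
  rw [this]
  refine Measurable.ite (measurableSet_injective n) ?_ measurable_const
  exact Finset.measurable_sum _ fun i _ =>
    ((measurable_one.indicator hA).comp (measurable_pi_apply i))

end SimplePointMeasure

/-! ### Uniform tuples and the mixture that gives the Poisson law -/

/-- Coordinates of a uniform random tuple have distinct images under a function with null fibres. -/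
lemma ae_comp_injective {φ : I → ℝ} (hφ : Measurable φ) (h0 : ∀ c, volume (φ ⁻¹' {c}) = 0)
    (n : ℕ) : ∀ᵐ x : Fin n → I, Function.Injective fun i => φ (x i) := by
  have key : ∀ i j : Fin n, i ≠ j → ∀ᵐ x : Fin n → I, φ (x i) ≠ φ (x j) := by
    intro i j hij
    obtain _ | m := n
    · exact i.elim0
    -- Split off coordinate `i`: for fixed other coordinates, a tie confines it to a null fibre, and
    -- Fubini concludes.
    obtain ⟨j', rfl⟩ := Fin.exists_succAbove_eq hij.symm
    have hm := volume_preserving_piFinSuccAbove (fun _ : Fin (m + 1) => I) i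
    have hS : MeasurableSet {p : I × (Fin m → I) | φ p.1 ≠ φ (p.2 j')} :=
      (measurableSet_eq_fun (by fun_prop) (by fun_prop)).compl
    have : ∀ᵐ p : I × (Fin m → I), φ p.1 ≠ φ (p.2 j') := by
      have := (Measure.ae_ae_comm (μ := (volume : Measure (Fin m → I)))
        (ν := (volume : Measure I)) (p := fun w v => φ v ≠ φ (w j'))
        (measurableSet_eq_fun (by fun_prop) (by fun_prop)).compl).1
        (.of_forall fun w => by
          rw [ae_iff]; simp only [ne_eq, not_not]; exact h0 (φ (w j')))
      exact (Measure.ae_prod_iff_ae_ae hS).2 this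
    exact hm.quasiMeasurePreserving.ae this
  have : ∀ᵐ x : Fin n → I, ∀ i j : Fin n, i ≠ j → φ (x i) ≠ φ (x j) := by
    rw [ae_all_iff]; intro i
    rw [ae_all_iff]; intro j
    by_cases h : i = j
    · simp [h]
    · filter_upwards [key i j h] with x hx _ using hx
  filter_upwards [this] with x hx i j hij
  by_contra hne
  exact hx i j hne hij

lemma ae_injective (n : ℕ) : ∀ᵐ x : Fin n → I, Function.Injective x := by
  filter_upwards [ae_comp_injective (φ := Subtype.val) measurable_subtype_coe (fun c => by
    refine Set.Subsingleton.measure_zero (fun a ha b hb => Subtype.ext ?_) _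
    exact ha.trans hb.symm) n] with x hx i j hij
  exact hx (congrArg Subtype.val hij)

namespace SimplePointMeasure

/-- The law of `n` independent uniform points. -/
noncomputable def unifLaw (n : ℕ) : Measure SimplePointMeasure :=
  (volume : Measure (Fin n → I)).map conf

instance (n : ℕ) : IsProbabilityMeasure (unifLaw n) :=
  Measure.isProbabilityMeasure_map (measurable_conf n).aemeasurable

lemma lintegral_unifLaw (n : ℕ) {g : SimplePointMeasure → ℝ≥0∞} (hg : Measurable g) :
    ∫⁻ ν, g ν ∂unifLaw n = ∫⁻ x : Fin n → I, g (conf x) :=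
  lintegral_map hg (measurable_conf n)

lemma ae_unifLaw_card (n : ℕ) : ∀ᵐ ν ∂unifLaw n, ν.pts.card = n := by
  refine (ae_map_iff (measurable_conf n).aemeasurable (measurableSet_cardSet n)).2 ?_
  filter_upwards [ae_injective n] with x hx using card_conf hx

/-- The law of a homogeneous Poisson process of intensity `r`. -/
noncomputable def poissonLaw (r : ℝ≥0) : Measure SimplePointMeasure :=
  Measure.sum fun n => poissonMeasure r {n} • unifLaw n

lemma poissonLaw_apply (r : ℝ≥0) {A : Set SimplePointMeasure} (hA : MeasurableSet A) :
    poissonLaw r A = ∑' n, poissonMeasure r {n} * unifLaw n A := by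
  simp [poissonLaw, Measure.sum_apply _ hA]

lemma tsum_poissonMeasure_singleton (r : ℝ≥0) : ∑' n, poissonMeasure r {n} = 1 := by
  simpa using (lintegral_countable' (μ := poissonMeasure r) (fun _ => 1)).symm

instance (r : ℝ≥0) : IsProbabilityMeasure (poissonLaw r) :=
  ⟨by simp [poissonLaw_apply, tsum_poissonMeasure_singleton]⟩

end SimplePointMeasure

/-! ### Counts under the mixture are Poisson and independent -/

namespace SimplePointMeasure

open scoped Classical in
/-- The number of points in a set. -/
noncomputable def cardIn (A : Set I) (ν : SimplePointMeasure) : ℕ :=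
  (ν.pts.filter (· ∈ A)).card

lemma toMeasure_eq_cardIn (ν : SimplePointMeasure) (A : Set I) :
    ν.toMeasure A = (cardIn A ν : ℝ≥0∞) := toMeasure_apply ν A

lemma measurable_cardIn {A : Set I} (hA : MeasurableSet A) : Measurable (cardIn A) := by
  refine measurable_to_countable' fun n => ?_
  have : cardIn A ⁻¹' {n} =
      (fun ν : SimplePointMeasure => ν.toMeasure A) ⁻¹' {(n : ℝ≥0∞)} := by
    ext ν; simp [toMeasure_eq_cardIn]
  rw [this]
  exact measurable_eval hA (measurableSet_singleton _)

lemma cardIn_conf {n : ℕ} {x : Fin n → I} (hx : Function.Injective x) (A : Set I) :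
    (cardIn A (conf x) : ℝ) = ∑ i, A.indicator 1 (x i) := by
  classical
  rw [cardIn, Finset.card_filter]
  push_cast
  rw [← sum_pts_conf hx]
  simp [Set.indicator_apply]

/-- Given `n` points the integrand is a product over independent uniform points, with mean `c ^ n`;
averaging over the Poisson number sums an exponential series. -/
lemma integral_poissonLaw_cexp {ι : Type*} [Fintype ι] (r : ℝ≥0) {A : ι → Set I}
    (hA : ∀ j, MeasurableSet (A j)) (θ : ι → ℝ) :
    ∫ ν, Complex.exp ((∑ j, θ j * cardIn (A j) ν : ℝ) * Complex.I) ∂poissonLaw r =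
      Complex.exp (r * ((∫ x : I,
        Complex.exp ((∑ j, θ j * (A j).indicator 1 x : ℝ) * Complex.I)) - 1)) := by
  set g : SimplePointMeasure → ℂ :=
    fun ν => Complex.exp ((∑ j, θ j * cardIn (A j) ν : ℝ) * Complex.I) with hg
  set c : ℂ := ∫ x : I, Complex.exp ((∑ j, θ j * (A j).indicator 1 x : ℝ) * Complex.I) with hc
  have hgm : Measurable g := by
    have : ∀ j, Measurable (cardIn (A j)) := fun j => measurable_cardIn (hA j)
    have h2 : ∀ j, Measurable fun ν => (cardIn (A j) ν : ℝ) := fun j =>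
      (measurable_from_top (f := fun n : ℕ => (n : ℝ))).comp (this j)
    fun_prop
  have hgi : Integrable g (poissonLaw r) := by
    refine Integrable.of_bound hgm.aestronglyMeasurable 1 (.of_forall fun ν => ?_)
    rw [hg]; exact (Complex.norm_exp_ofReal_mul_I _).le
  have hn : ∀ n, ∫ ν, g ν ∂unifLaw n = c ^ n := by
    intro n
    rw [unifLaw, integral_map (measurable_conf n).aemeasurable hgm.aestronglyMeasurable]
    have : ∫ x : Fin n → I, g (conf x) = ∫ x : Fin n → I,
        ∏ i, Complex.exp ((∑ j, θ j * (A j).indicator 1 (x i) : ℝ) * Complex.I) := by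
      refine integral_congr_ae ?_
      filter_upwards [ae_injective n] with x hx
      rw [hg, ← Complex.exp_sum]
      simp only [cardIn_conf hx, Finset.mul_sum]
      rw [Finset.sum_comm, ← Finset.sum_mul]
      push_cast
      rfl
    rw [this, integral_fintype_prod_volume_eq_pow
      (fun y : I => Complex.exp ((∑ j, θ j * (A j).indicator 1 y : ℝ) * Complex.I))]
    simp [hc]
  have h1 := hasSum_integral_measure (μ := fun n => poissonMeasure r {n} • unifLaw n) hgi
  have h2 : (fun n => ∫ ν, g ν ∂(poissonMeasure r {n} • unifLaw n)) = fun n =>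
      (Real.exp (-r) : ℂ) * ((r * c) ^ n / (n.factorial : ℂ)) := by
    ext n
    rw [integral_smul_measure, hn, poissonMeasure_singleton, ENNReal.toReal_ofReal (by positivity),
      Complex.real_smul]
    push_cast
    ring
  rw [h2] at h1
  have h3 := (NormedSpace.expSeries_div_hasSum_exp ((r : ℂ) * c)).mul_left (Real.exp (-r) : ℂ)
  change ∫ ν, g ν ∂poissonLaw r = _
  rw [poissonLaw, h1.unique h3, ← Complex.exp_eq_exp_ℂ, Complex.ofReal_exp, ← Complex.exp_add]
  push_cast
  ring_nf

/-- Disjointness leaves at most one nonzero term in the exponent, so the integral becomes additive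
over the sets. After exponentiation this is the factorization that gives independence. -/
lemma integral_cexp_indicator {ι : Type*} [Fintype ι] {A : ι → Set I}
    (hA : ∀ j, MeasurableSet (A j)) (hd : Pairwise fun i j => Disjoint (A i) (A j)) (θ : ι → ℝ) :
    (∫ x : I, Complex.exp ((∑ j, θ j * (A j).indicator 1 x : ℝ) * Complex.I)) - 1 =
      ∑ j, (volume.real (A j) : ℂ) * (Complex.exp (θ j * Complex.I) - 1) := by
  have : ∀ x : I, Complex.exp ((∑ j, θ j * (A j).indicator 1 x : ℝ) * Complex.I) =
      1 + ∑ j, (A j).indicator (fun _ => Complex.exp (θ j * Complex.I) - 1) x := by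
    intro x
    by_cases h : ∃ j, x ∈ A j
    · obtain ⟨j, hj⟩ := h
      have hk : ∀ k, k ≠ j → x ∉ A k := fun k hk hx => Set.disjoint_left.1 (hd hk) hx hj
      rw [Finset.sum_eq_single j (by intro k _ h; simp [hk k h]) (by simp),
        Finset.sum_eq_single j (by intro k _ h; simp [hk k h]) (by simp)]
      simp [hj]
    · push Not at h
      simp [h]
  simp_rw [this]
  rw [integral_add (integrable_const _) (integrable_finsetSum _ fun j _ =>
    (integrable_const _).indicator (hA j)), integral_finsetSum _ fun j _ =>
    (integrable_const _).indicator (hA j)]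
  simp [integral_indicator, hA, Measure.real]

lemma charFun_cardIn (r : ℝ≥0) {A : Set I} (hA : MeasurableSet A) (t : ℝ) :
    charFun ((poissonLaw r).map fun ν => (cardIn A ν : ℝ)) t =
      Complex.exp (r * (volume.real A * (Complex.exp (t * Complex.I) - 1))) := by
  have hm : Measurable fun ν => (cardIn A ν : ℝ) :=
    (measurable_from_top (f := fun n : ℕ => (n : ℝ))).comp (measurable_cardIn hA)
  have h := integral_poissonLaw_cexp (ι := Unit) r (A := fun _ => A) (fun _ => hA) (fun _ => t)
  rw [integral_cexp_indicator (fun _ => hA) (by intro i j h; exact absurd rfl h)] at h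
  rw [charFun_apply, integral_map hm.aemeasurable (by fun_prop)]
  simp only [Finset.univ_unique, Finset.sum_singleton] at h
  rw [← h]
  simp [mul_comm]

lemma map_cardIn_poissonLaw (r : ℝ≥0) {A : Set I} (hA : MeasurableSet A) :
    (poissonLaw r).map (cardIn A) = poissonMeasure (r * (volume A).toNNReal) := by
  apply (MeasurableEmbedding.natCast (α := ℝ)).map_injective
  rw [Measure.map_map (by fun_prop) (measurable_cardIn hA)]
  have hm : Measurable fun ν => (cardIn A ν : ℝ) :=
    (measurable_from_top (f := fun n : ℕ => (n : ℝ))).comp (measurable_cardIn hA)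
  have := Measure.isProbabilityMeasure_map (μ := poissonLaw r) hm.aemeasurable
  refine Measure.ext_of_charFun (funext fun t => ?_)
  rw [charFun_map_cast_poissonMeasure]
  refine (charFun_cardIn r hA t).trans ?_
  simp [Measure.real, ENNReal.toReal, mul_assoc]

lemma iIndepFun_cardIn (r : ℝ≥0) {ι : Type*} [Fintype ι] {A : ι → Set I}
    (hA : ∀ j, MeasurableSet (A j)) (hd : Pairwise fun i j => Disjoint (A i) (A j)) :
    iIndepFun (fun j ν => (cardIn (A j) ν : ℝ)) (poissonLaw r) := by
  have hm : ∀ j, Measurable fun ν => (cardIn (A j) ν : ℝ) := fun j =>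
    (measurable_from_top (f := fun n : ℕ => (n : ℝ))).comp (measurable_cardIn (hA j))
  rw [iIndepFun_iff_charFun_pi fun j => (hm j).aemeasurable]
  intro t
  have hm' : Measurable fun ν => WithLp.toLp 2 fun j => (cardIn (A j) ν : ℝ) := by
    fun_prop
  simp_rw [charFun_cardIn r (hA _)]
  rw [← Complex.exp_sum, ← Finset.mul_sum, ← integral_cexp_indicator hA hd,
    ← integral_poissonLaw_cexp r hA, charFun_apply, integral_map hm'.aemeasurable (by fun_prop)]
  simp [PiLp.inner_apply]

end SimplePointMeasure

open SimplePointMeasure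

lemma isPoissonProcess_poissonLaw (r : ℝ≥0) : IsPoissonProcess r id (poissonLaw r) where
  measurable := measurable_id
  count_law A hA n := by
    rw [← map_cardIn_poissonLaw r hA, Measure.map_apply (measurable_cardIn hA) (by measurability)]
    congr 1; ext ν; simp [toMeasure_eq_cardIn]
  indep m A hA hd := by
    have := (iIndepFun_cardIn r hA hd).comp (fun _ => ENNReal.ofReal)
      fun _ => ENNReal.measurable_ofReal
    convert this using 2 with i
    ext ν; simp [toMeasure_eq_cardIn]

/-! ### Uniqueness of the law and reduction of thinnings to laws -/

/-- Being a Poisson process is a property of the law. -/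
lemma isPoissonProcess_iff_map {Ω : Type*} [MeasurableSpace Ω] {r : ℝ≥0}
    {Z : Ω → SimplePointMeasure} {P : Measure Ω} [IsProbabilityMeasure P] (hZ : Measurable Z) :
    IsPoissonProcess r Z P ↔ IsPoissonProcess r id (P.map Z) := by
  have := Measure.isProbabilityMeasure_map (μ := P) hZ.aemeasurable
  have hc : ∀ A : Set I, MeasurableSet A → ∀ n : ℕ,
      (P.map Z) {ν | ν.toMeasure A = n} = P {ω | (Z ω).toMeasure A = n} := fun A hA n =>
    Measure.map_apply hZ (measurable_eval hA (measurableSet_singleton _))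
  have hi : ∀ (m : ℕ) (A : Fin m → Set I), (∀ i, MeasurableSet (A i)) →
      (iIndepFun (fun i ω => (Z ω).toMeasure (A i)) P ↔
        iIndepFun (fun i ν => ν.toMeasure (A i)) (P.map Z)) := by
    intro m A hA
    have hm : ∀ i, Measurable fun ω => (Z ω).toMeasure (A i) := fun i =>
      (measurable_eval (hA i)).comp hZ
    rw [iIndepFun_iff_map_fun_eq_pi_map fun i => (hm i).aemeasurable,
      iIndepFun_iff_map_fun_eq_pi_map fun i => (measurable_eval (hA i)).aemeasurable,
      Measure.map_map (measurable_pi_iff.2 fun i => measurable_eval (hA i)) hZ]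
    simp_rw [Measure.map_map (measurable_eval (hA _)) hZ]
    rfl
  exact ⟨fun h => ⟨measurable_id, fun A hA n => (hc A hA n).trans (h.count_law A hA n),
      fun m A hA hd => (hi m A hA).1 (h.indep m A hA hd)⟩,
    fun h => ⟨hZ, fun A hA n => (hc A hA n).symm.trans (h.count_law A hA n),
      fun m A hA hd => (hi m A hA).2 (h.indep m A hA hd)⟩⟩

lemma IsPoissonProcess.map_toMeasure {r : ℝ≥0} {μ : Measure SimplePointMeasure}
    (h : IsPoissonProcess r id μ) {A : Set I} (hA : MeasurableSet A) :
    μ.map (fun ν => ν.toMeasure A) =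
      (poissonMeasure (r * (volume A).toNNReal)).map fun n : ℕ => (n : ℝ≥0∞) := by
  have : μ.map (cardIn A) = poissonMeasure (r * (volume A).toNNReal) := by
    refine Measure.ext_of_singleton fun n => ?_
    rw [← h.count_law A hA, Measure.map_apply (measurable_cardIn hA) (measurableSet_singleton n)]
    congr 1; ext ν; simp [toMeasure_eq_cardIn]
  rw [← this, Measure.map_map measurable_from_top (measurable_cardIn hA)]
  congr 1; ext ν; simp [toMeasure_eq_cardIn]

/-- The joint law of the numbers of points in finitely many disjoint sets. -/
lemma IsPoissonProcess.map_toMeasure_pi {r : ℝ≥0} {μ : Measure SimplePointMeasure}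
    [IsProbabilityMeasure μ] (h : IsPoissonProcess r id μ) {m : ℕ} {A : Fin m → Set I}
    (hA : ∀ j, MeasurableSet (A j)) (hd : Pairwise fun i j => Disjoint (A i) (A j)) :
    μ.map (fun ν j => ν.toMeasure (A j)) = Measure.pi fun j =>
      (poissonMeasure (r * (volume (A j)).toNNReal)).map fun n : ℕ => (n : ℝ≥0∞) := by
  simp_rw [← h.map_toMeasure (hA _)]
  exact (iIndepFun_iff_map_fun_eq_pi_map fun j =>
    (measurable_eval (hA j)).aemeasurable).1 (h.indep m A hA hd)

/-- The numbers of points in finitely many sets are sums of those in disjoint pieces. -/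
lemma exists_disjoint_decomposition {κ : Type*} [Finite κ] {A : κ → Set I}
    (hA : ∀ j, MeasurableSet (A j)) : ∃ (m : ℕ) (B : Fin m → Set I)
    (S : (Fin m → ℝ≥0∞) → (κ → ℝ≥0∞)), (∀ j, MeasurableSet (B j)) ∧
      (Pairwise fun i j => Disjoint (B i) (B j)) ∧ Measurable S ∧
      ∀ ν : Measure I, (fun j => ν (A j)) = S fun b => ν (B b) := by
  classical
  have := Fintype.ofFinite κ
  set e := (Fintype.equivFin (κ → Bool)).symm
  -- The atoms of the algebra generated by the sets, one for each pattern of membership.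
  set At : Fin (Fintype.card (κ → Bool)) → Set I := fun b =>
    ⋂ j, if e b j then A j else (A j)ᶜ with hAt
  have hmem : ∀ b x, x ∈ At b ↔ ∀ j, (e b j = true ↔ x ∈ A j) := by
    intro b x
    refine Set.mem_iInter.trans (forall_congr' fun j => ?_)
    by_cases h : e b j = true <;> simp [h]
  have hAtm : ∀ b, MeasurableSet (At b) := fun b => .iInter fun j => by
    split_ifs
    exacts [hA j, (hA j).compl]
  have hd : Pairwise fun i j => Disjoint (At i) (At j) := by
    intro b c hbc
    refine Set.disjoint_left.2 fun x hx hx' => hbc (e.injective (funext fun j => ?_))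
    rw [Bool.eq_iff_iff, (hmem b x).1 hx j, (hmem c x).1 hx' j]
  refine ⟨_, At, fun y j => ∑ b, if e b j then y b else 0, hAtm, hd, ?_, fun ν => ?_⟩
  · refine measurable_pi_iff.2 fun A => Finset.measurable_sum _ fun b _ => ?_
    split_ifs <;> fun_prop
  · ext j
    have hu : A j = ⋃ b ∈ (Finset.univ.filter fun b => e b j = true), At b := by
      ext x
      simp only [Finset.mem_filter, Finset.mem_univ, true_and, Set.mem_iUnion, exists_prop]
      constructor
      · intro hx
        exact ⟨e.symm fun i => decide (x ∈ A i), by simp [hx], (hmem _ _).2 fun i => by simp⟩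
      · rintro ⟨b, hb, hx⟩
        exact ((hmem b x).1 hx j).1 hb
    rw [hu, measure_biUnion_finset (fun i _ j _ hij => hd hij) fun b _ => hAtm b,
      Finset.sum_filter]

/-- The σ-algebra is pulled back from the product along all evaluations, so a law is determined by
its image there. -/
lemma SimplePointMeasure.exists_measurableSet_preimage_eq {S : Set SimplePointMeasure}
    (hS : MeasurableSet S) : ∃ T : Set ({A : Set I // MeasurableSet A} → ℝ≥0∞),
      MeasurableSet T ∧ (fun (ν : SimplePointMeasure) (A : {A : Set I // MeasurableSet A}) =>
        ν.toMeasure A.1) ⁻¹' T = S := by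
  have : @Measurable _ _ (MeasurableSpace.comap
      (fun (ν : SimplePointMeasure) (A : {A : Set I // MeasurableSet A}) => ν.toMeasure A.1)
        MeasurableSpace.pi) _ (id : SimplePointMeasure → SimplePointMeasure) := by
    refine @measurable_of_eval _ (_) _ fun A hA => ?_
    exact (measurable_pi_apply (X := fun _ : {A : Set I // MeasurableSet A} => ℝ≥0∞)
      ⟨A, hA⟩).comp (comap_measurable _)
  exact this hS

/-- The law of a Poisson process is determined by its intensity. -/
lemma IsPoissonProcess.law_unique {r : ℝ≥0} {μ μ' : Measure SimplePointMeasure}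
    [IsProbabilityMeasure μ] [IsProbabilityMeasure μ']
    (h : IsPoissonProcess r id μ) (h' : IsPoissonProcess r id μ') : μ = μ' := by
  set F : SimplePointMeasure → ({A : Set I // MeasurableSet A} → ℝ≥0∞) :=
    fun ν A => ν.toMeasure A.1 with hF
  have hFm : Measurable F := measurable_pi_iff.2 fun A => measurable_eval A.2
  have hFP := Measure.isProbabilityMeasure_map (μ := μ') hFm.aemeasurable
  have key : ∀ J : Finset {A : Set I // MeasurableSet A},
      (μ.map F).map J.restrict = (μ'.map F).map J.restrict := by
    intro J
    obtain ⟨m, B, S, hB, hd, hS, hdec⟩ := exists_disjoint_decomposition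
      (A := fun j : J => j.1.1) fun j => j.1.2
    have hm : Measurable fun (ν : SimplePointMeasure) b => ν.toMeasure (B b) :=
      measurable_pi_iff.2 fun b => measurable_eval (hB b)
    have hc : J.restrict ∘ F = S ∘ fun (ν : SimplePointMeasure) b => ν.toMeasure (B b) := by
      ext ν : 1
      exact hdec ν.toMeasure
    rw [Measure.map_map (by fun_prop) hFm, Measure.map_map (by fun_prop) hFm, hc,
      ← Measure.map_map hS hm, ← Measure.map_map hS hm, h.map_toMeasure_pi hB hd,
      h'.map_toMeasure_pi hB hd]
  -- Measures on the product with the same finite-dimensional marginals agree.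
  have main : μ.map F = μ'.map F :=
    IsProjectiveLimit.unique (P := fun J => (μ'.map F).map J.restrict)
      (fun J => key J) (fun J => rfl)
  refine Measure.ext fun S hS => ?_
  obtain ⟨T, hT, rfl⟩ := exists_measurableSet_preimage_eq hS
  change μ (F ⁻¹' T) = μ' (F ⁻¹' T)
  rw [← Measure.map_apply hFm hT, ← Measure.map_apply hFm hT, main]

lemma isPoissonProcess_iff {Ω : Type*} [MeasurableSpace Ω] {r : ℝ≥0}
    {Z : Ω → SimplePointMeasure} {P : Measure Ω} [IsProbabilityMeasure P] (hZ : Measurable Z) :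
    IsPoissonProcess r Z P ↔ P.map Z = poissonLaw r := by
  have := Measure.isProbabilityMeasure_map (μ := P) hZ.aemeasurable
  rw [isPoissonProcess_iff_map hZ]
  exact ⟨fun h => h.law_unique (isPoissonProcess_poissonLaw r),
    fun h => h ▸ isPoissonProcess_poissonLaw r⟩

/-- A thinning is a measurable map of configurations into subconfigurations that carries one
Poisson law to the other. -/
lemma isThinning_iff {lam mu : ℝ≥0} {f : SimplePointMeasure → SimplePointMeasure}
    (hf : Measurable f) : IsThinning lam mu f ↔ (poissonLaw lam).map f = poissonLaw mu ∧
      ∀ᵐ ν ∂poissonLaw lam, (f ν).pts ⊆ ν.pts := by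
  simp_rw [← Finset.coe_subset, coe_pts]
  constructor
  · intro h
    exact ⟨(isPoissonProcess_iff hf).1
        (IsThinning.isPoissonProcess h _ _ id (isPoissonProcess_poissonLaw lam)),
      h.points_subset _ _ id (isPoissonProcess_poissonLaw lam)⟩
  · rintro ⟨h1, h2⟩
    refine ⟨hf, fun Ω _ P _ Z hZ => ?_, fun Ω _ P _ Z hZ => ?_⟩
    · refine (isPoissonProcess_iff (hf.comp hZ.measurable)).2 ?_
      rw [← h1, ← (isPoissonProcess_iff hZ.measurable).1 hZ, Measure.map_map hf hZ.measurable]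
    · rw [← (isPoissonProcess_iff hZ.measurable).1 hZ] at h2
      exact ae_of_ae_map hZ.measurable.aemeasurable h2

/-! ### Poisson weights and the necessary condition -/

/-- The Poisson weight `e⁻ʳ rⁿ / n!`. -/
noncomputable def poissonWeight (r : ℝ) (n : ℕ) : ℝ := Real.exp (-r) * r ^ n / n.factorial

/-- The Poisson distribution function. -/
noncomputable def poissonCDF (r : ℝ) (n : ℕ) : ℝ := ∑ i ∈ Finset.range (n + 1), poissonWeight r i

lemma poissonWeight_pos {r : ℝ} (hr : 0 < r) (n : ℕ) : 0 < poissonWeight r n := by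
  unfold poissonWeight; positivity

lemma poissonWeight_nonneg (r : ℝ≥0) (n : ℕ) : 0 ≤ poissonWeight r n := by
  unfold poissonWeight; positivity

lemma poissonMeasure_singleton_eq (r : ℝ≥0) (n : ℕ) :
    poissonMeasure r {n} = ENNReal.ofReal (poissonWeight r n) := poissonMeasure_singleton r n

lemma poissonCDF_succ (r : ℝ) (n : ℕ) :
    poissonCDF r (n + 1) = poissonCDF r n + poissonWeight r (n + 1) := Finset.sum_range_succ _ _

lemma poissonMeasure_le (r : ℝ≥0) (n : ℕ) :
    poissonMeasure r {i | i ≤ n} = ENNReal.ofReal (poissonCDF r n) := by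
  have : {i | i ≤ n} = ((Finset.range (n + 1) : Finset ℕ) : Set ℕ) := by ext; simp
  rw [this, poissonCDF, ENNReal.ofReal_sum_of_nonneg fun i _ => poissonWeight_nonneg r i,
    ← sum_measure_singleton]
  simp_rw [poissonMeasure_singleton_eq]

namespace SimplePointMeasure

lemma map_card_poissonLaw (r : ℝ≥0) :
    (poissonLaw r).map (fun ν => ν.pts.card) = poissonMeasure r := by
  have h := map_cardIn_poissonLaw r MeasurableSet.univ
  simp only [measure_univ, ENNReal.toNNReal_one, mul_one] at h
  rw [← h]
  congr 1; ext ν; simp [cardIn]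

lemma poissonLaw_card_le (r : ℝ≥0) (n : ℕ) :
    poissonLaw r {ν | ν.pts.card ≤ n} = ENNReal.ofReal (poissonCDF r n) := by
  rw [← poissonMeasure_le, ← map_card_poissonLaw,
    Measure.map_apply measurable_card (by measurability)]
  rfl

lemma poissonLaw_restrict_cardSet (r : ℝ≥0) (n : ℕ) :
    (poissonLaw r).restrict (cardSet n) = ENNReal.ofReal (poissonWeight r n) • unifLaw n := by
  refine Measure.ext fun A hA => ?_
  rw [Measure.restrict_apply hA, poissonLaw_apply r (hA.inter (measurableSet_cardSet n)),
    tsum_eq_single n]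
  · rw [Measure.smul_apply, smul_eq_mul, poissonMeasure_singleton_eq]
    congr 1
    refine measure_congr ?_
    filter_upwards [ae_unifLaw_card n] with ν hν
    exact propext ⟨fun h => h.1, fun h => ⟨h, hν⟩⟩
  · intro m hm
    have : unifLaw m (A ∩ cardSet n) = 0 := by
      refine measure_mono_null Set.inter_subset_right ?_
      rw [measure_eq_zero_iff_ae_notMem]
      filter_upwards [ae_unifLaw_card m] with ν hν h
      exact hm (hν.symm.trans h)
    rw [this, mul_zero]

end SimplePointMeasure

open SimplePointMeasure

/-- A thinning almost never keeps all of `n` points, if `n` points are less likely under the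
thinned intensity. -/
lemma IsThinning.ae_ne {lam mu : ℝ≥0} {f : SimplePointMeasure → SimplePointMeasure}
    (hf : IsThinning lam mu f) {n : ℕ} (hn : poissonWeight mu n < poissonWeight lam n) :
    ∀ᵐ ν ∂poissonLaw lam, ¬ (ν.pts.card = n ∧ f ν = ν) := by
  have hmap := ((isThinning_iff hf.measurable).1 hf).1
  set B : Set SimplePointMeasure := {ν | ν.pts.card = n ∧ f ν = ν}
  have hBc : B ⊆ cardSet n := fun ν h => h.1
  -- Measurability of `B` is not needed: a measurable hull of the same uniform mass takes its place.
  set T := toMeasurable (unifLaw n) B ∩ cardSet n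
  have hTm : MeasurableSet T := (measurableSet_toMeasurable _ _).inter (measurableSet_cardSet n)
  have hBT : B ⊆ T := Set.subset_inter (subset_toMeasurable _ _) hBc
  have hr : ∀ (r : ℝ≥0) (S : Set SimplePointMeasure), S ⊆ cardSet n →
      poissonLaw r S = ENNReal.ofReal (poissonWeight r n) * unifLaw n S := by
    intro r S hS
    have := congrArg (fun m : Measure SimplePointMeasure => m S) (poissonLaw_restrict_cardSet r n)
    simpa [Measure.restrict_apply' (measurableSet_cardSet n), Set.inter_eq_left.2 hS] using this
  have h1 : poissonLaw lam B ≤ poissonLaw mu T := by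
    rw [← hmap, Measure.map_apply hf.measurable hTm]
    refine measure_mono fun ν hν => ?_
    rw [Set.mem_preimage, hν.2]
    exact hBT hν
  rw [hr _ _ hBc, hr _ _ Set.inter_subset_right] at h1
  have h2 : unifLaw n T ≤ unifLaw n B :=
    (measure_mono Set.inter_subset_left).trans (measure_toMeasurable B).le
  have h3 := h1.trans (mul_le_mul_right h2 _)
  have h0 : unifLaw n B = 0 := by
    by_contra h0
    rw [ENNReal.mul_le_mul_iff_left h0 (measure_ne_top _ _)] at h3
    exact absurd h3 (not_le.2 ((ENNReal.ofReal_lt_ofReal_iff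
      ((poissonWeight_nonneg mu n).trans_lt hn)).2 hn))
  rw [ae_iff]
  simp only [not_not]
  change poissonLaw lam B = 0
  rw [hr _ _ hBc, h0, mul_zero]

/-- Among configurations of at most `n + 1` points, only those of exactly `n + 1` points kept whole
could retain more than `n`, and these are null by `IsThinning.ae_ne`. -/
lemma IsThinning.poissonCDF_le {lam mu : ℝ≥0} {f : SimplePointMeasure → SimplePointMeasure}
    (hf : IsThinning lam mu f) {n : ℕ}
    (hn : poissonWeight mu (n + 1) < poissonWeight lam (n + 1)) :
    poissonCDF lam (n + 1) ≤ poissonCDF mu n := by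
  obtain ⟨hmap, hsub⟩ := (isThinning_iff hf.measurable).1 hf
  have hm : 0 ≤ poissonCDF mu n := Finset.sum_nonneg fun i _ => poissonWeight_nonneg mu i
  rw [← ENNReal.ofReal_le_ofReal_iff hm, ← poissonLaw_card_le, ← poissonLaw_card_le, ← hmap,
    Measure.map_apply hf.measurable (s := {ν | ν.pts.card ≤ n})
      (measurable_card (.of_discrete (s := {i | i ≤ n})))]
  refine measure_mono_ae ?_
  filter_upwards [hsub, hf.ae_ne hn] with ν h1 h2 h3
  change ν.pts.card ≤ n + 1 at h3
  change (f ν).pts.card ≤ n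
  by_contra h4
  have h5 := Finset.card_le_card h1
  exact h2 ⟨by omega, pts_injective (Finset.eq_of_subset_of_card_le h1 (by omega))⟩

/-! ### Calculus of the condition on the intensities -/

/-- The likelihood ratio of the Poisson weights at `n`. -/
noncomputable def poissonRatio (m : ℝ) (n : ℕ) (r : ℝ) : ℝ := (r / m) ^ n * Real.exp (m - r)

lemma poissonWeight_eq_mul {m : ℝ} (hm : 0 < m) (n : ℕ) (r : ℝ) :
    poissonWeight r n = poissonWeight m n * poissonRatio m n r := by
  unfold poissonWeight poissonRatio
  rw [show m - r = -r - (-m) by ring, Real.exp_sub, div_pow]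
  field_simp

lemma poissonWeight_lt_iff {m : ℝ} (hm : 0 < m) (n : ℕ) (r : ℝ) :
    poissonWeight m n < poissonWeight r n ↔ 1 < poissonRatio m n r := by
  rw [poissonWeight_eq_mul hm n r, lt_mul_iff_one_lt_right (poissonWeight_pos hm n)]

lemma poissonRatio_nonneg {m r : ℝ} (hm : 0 < m) (hr : 0 ≤ r) (n : ℕ) :
    0 ≤ poissonRatio m n r := by
  unfold poissonRatio; positivity

lemma continuous_poissonRatio (m : ℝ) (n : ℕ) : Continuous (poissonRatio m n) := by
  unfold poissonRatio; fun_prop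

/-- The derivative of the weight at `n + 1` is the weight at `n` minus the weight at `n + 1`, so the
sum telescopes. -/
lemma hasDerivAt_poissonCDF (n : ℕ) (r : ℝ) :
    HasDerivAt (fun r => poissonCDF r n) (-poissonWeight r n) r := by
  have hw : ∀ n, HasDerivAt (fun r => poissonWeight r n)
      (-Real.exp (-r) * r ^ n / n.factorial +
        Real.exp (-r) * (n * r ^ (n - 1)) / n.factorial) r := by
    intro n
    have := (((hasDerivAt_id r).neg.exp).mul (hasDerivAt_pow n r)).div_const (n.factorial : ℝ)
    refine this.congr_deriv ?_
    simp only [id, Pi.neg_apply]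
    ring
  induction n with
  | zero =>
    refine ((hw 0).congr_deriv (by simp [poissonWeight])).congr_of_eventuallyEq ?_
    exact .of_forall fun r => by simp [poissonCDF]
  | succ n ih =>
    simp_rw [poissonCDF_succ]
    refine (ih.add (hw (n + 1))).congr_deriv ?_
    unfold poissonWeight
    rw [Nat.factorial_succ]
    push_cast
    field_simp
    simp

lemma integral_poissonWeight (n : ℕ) (a b : ℝ) :
    ∫ r in a..b, poissonWeight r n = poissonCDF a n - poissonCDF b n := by
  have hc : Continuous fun r => poissonWeight r n := by unfold poissonWeight; fun_prop
  have := intervalIntegral.integral_eq_sub_of_hasDerivAt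
    (fun r _ => hasDerivAt_poissonCDF n r) (hc.neg.intervalIntegrable a b)
  rw [intervalIntegral.integral_neg] at this
  linarith

/-- Both sides say that the weight of `m` at `n + 1` is at most the drop of the distribution
function at `n + 1` between `m` and `l`, which is the integral of the weights. -/
lemma poissonCDF_succ_le_iff {m : ℝ} (hm : 0 < m) (n : ℕ) (l : ℝ) :
    poissonCDF l (n + 1) ≤ poissonCDF m n ↔ 1 ≤ ∫ r in m..l, poissonRatio m (n + 1) r := by
  have h := integral_poissonWeight (n + 1) m l
  rw [funext fun r => poissonWeight_eq_mul hm (n + 1) r,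
    intervalIntegral.integral_const_mul] at h
  rw [poissonCDF_succ m n] at h
  rw [← le_mul_iff_one_le_right (poissonWeight_pos hm (n + 1)), h]
  constructor <;> intro h <;> linarith

/-- The condition on the intensities that characterizes the existence of a thinning. -/
def ThinningCondition (l m : ℝ) : Prop :=
  ∀ n : ℕ, 1 < poissonRatio m (n + 1) l → 1 ≤ ∫ r in m..l, poissonRatio m (n + 1) r

lemma IsThinning.thinningCondition {lam mu : ℝ≥0} (hmu : 0 < mu)
    {f : SimplePointMeasure → SimplePointMeasure} (hf : IsThinning lam mu f) :
    ThinningCondition lam mu := fun n hn =>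
  (poissonCDF_succ_le_iff (NNReal.coe_pos.2 hmu) n lam).1
    (hf.poissonCDF_le ((poissonWeight_lt_iff (NNReal.coe_pos.2 hmu) _ _).2 hn))

lemma one_lt_poissonRatio_iff {m r : ℝ} (hm : 0 < m) (hr : 0 < r) (n : ℕ) :
    1 < poissonRatio m n r ↔ r - m < n * Real.log (r / m) := by
  have : poissonRatio m n r = Real.exp (n * Real.log (r / m) - (r - m)) := by
    rw [poissonRatio, show n * Real.log (r / m) - (r - m) = n * Real.log (r / m) + (m - r) by ring,
      Real.exp_add, Real.exp_nat_mul, Real.exp_log (by positivity)]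
  rw [this, Real.one_lt_exp_iff, sub_pos]

/-- The logarithm of the ratio is concave in the intensity and vanishes at `m`; positive at `l`, it
is positive throughout `(m, l]`. -/
lemma one_lt_poissonRatio_of_lt {m s l : ℝ} (hm : 0 < m) (hs : m < s) (hl : s ≤ l) {n : ℕ}
    (h : 1 < poissonRatio m n l) : 1 < poissonRatio m n s := by
  have hl0 : 0 < l := by linarith
  have hs0 : 0 < s := by linarith
  rw [one_lt_poissonRatio_iff hm hs0]
  rw [one_lt_poissonRatio_iff hm hl0] at h
  set t := (s - m) / (l - m) with ht
  have ht0 : 0 < t := div_pos (by linarith) (by linarith)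
  have ht1 : t ≤ 1 := (div_le_one (by linarith)).2 (by linarith)
  have hts : t * (l - m) = s - m := div_mul_cancel₀ _ (by linarith)
  have hconc := strictConcaveOn_log_Ioi.concaveOn.2 (Set.mem_Ioi.2 one_pos)
    (Set.mem_Ioi.2 (show 0 < l / m by positivity)) (sub_nonneg.2 ht1) ht0.le (by ring)
  have he : (1 - t) • (1 : ℝ) + t • (l / m) = s / m := by
    simp only [smul_eq_mul]
    field_simp
    linarith
  rw [he] at hconc
  simp only [smul_eq_mul, Real.log_one, mul_zero, zero_add] at hconc
  calc s - m = t * (l - m) := hts.symm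
    _ < t * (n * Real.log (l / m)) := by gcongr
    _ = n * (t * Real.log (l / m)) := by ring
    _ ≤ _ := by gcongr

/-- A larger `l'` adds a nonnegative piece to the integral, and a ratio above 1 at `l'` is already
above 1 at `l`. -/
lemma ThinningCondition.mono {l l' m : ℝ} (hm : 0 < m) (hl : m < l) (hl' : l ≤ l')
    (h : ThinningCondition l m) : ThinningCondition l' m := by
  intro n hn
  refine (h n (one_lt_poissonRatio_of_lt hm hl hl' hn)).trans ?_
  have hi : ∀ a b, IntervalIntegrable (poissonRatio m (n + 1)) volume a b := fun a b =>
    (continuous_poissonRatio m (n + 1)).intervalIntegrable a b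
  rw [← intervalIntegral.integral_add_adjacent_intervals (hi m l) (hi l l')]
  exact le_add_of_nonneg_right (intervalIntegral.integral_nonneg hl' fun u hu =>
    poissonRatio_nonneg hm (by linarith [hu.1]) (n + 1))

/-- After taking logarithms: `(c - 1) t ≤ 1 - 1/c ≤ log c`. -/
lemma exp_neg_le_mul_exp_neg {c t : ℝ} (hc : 1 ≤ c) (hct : c * t ≤ 1) :
    Real.exp (-t) ≤ c * Real.exp (-(c * t)) := by
  have hc0 : 0 < c := by linarith
  have h1 : 1 - c⁻¹ ≤ Real.log c := Real.one_sub_inv_le_log_of_pos hc0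
  have ht : t ≤ c⁻¹ := by rw [← one_div]; exact (le_div_iff₀' hc0).2 hct
  have h2 : (c - 1) * t ≤ 1 - c⁻¹ := by
    calc (c - 1) * t ≤ (c - 1) * c⁻¹ := by gcongr
      _ = 1 - c⁻¹ := by field_simp
  calc Real.exp (-t) ≤ Real.exp (Real.log c + -(c * t)) := Real.exp_le_exp.2 (by linarith)
    _ = c * Real.exp (-(c * t)) := by rw [Real.exp_add, Real.exp_log hc0]

lemma ThinningCondition.scale {l m c : ℝ} (hm : 0 < m) (hl : m < l) (hc : 1 ≤ c)
    (h : ThinningCondition l m) : ThinningCondition (c * l) (c * m) := by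
  intro n hn
  have hc0 : 0 < c := by linarith
  have hcl : c * m < c * l := by gcongr
  have hi : ∀ a b, IntervalIntegrable (poissonRatio (c * m) (n + 1)) volume a b := fun a b =>
    (continuous_poissonRatio _ (n + 1)).intervalIntegrable a b
  rcases le_total 1 (c * l - c * m) with hlong | hshort
  -- The integrand exceeds 1 on an interval of length at least 1.
  · calc (1 : ℝ) ≤ ∫ _ in (c * m)..(c * l), (1 : ℝ) := by simpa using hlong
      _ ≤ _ := by
        refine intervalIntegral.integral_mono_on_of_le_Ioo hcl.le (by simp) (hi _ _) fun s hs => ?_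
        exact (one_lt_poissonRatio_of_lt (by positivity) hs.1 hs.2.le hn).le
  -- Scaling fixes the power and shrinks the exponential factor, so the hypothesis passes to the
  -- unscaled pair. Substituting `r = c * s` then compares the two integrals pointwise.
  · have hn' : 1 < poissonRatio m (n + 1) l := by
      refine hn.trans_le ?_
      unfold poissonRatio
      rw [mul_div_mul_left _ _ hc0.ne']
      have : 0 < l := by linarith
      exact mul_le_mul_of_nonneg_left (Real.exp_le_exp.2 (by nlinarith)) (by positivity)
    refine (h n hn').trans ?_
    have hsub := intervalIntegral.mul_integral_comp_mul_left (a := m) (b := l)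
      (f := poissonRatio (c * m) (n + 1)) (c := c)
    rw [← hsub, ← intervalIntegral.integral_const_mul]
    have hc1 := continuous_poissonRatio (c * m) (n + 1)
    refine intervalIntegral.integral_mono_on hl.le
      ((continuous_poissonRatio m (n + 1)).intervalIntegrable _ _)
      (Continuous.intervalIntegrable (by fun_prop) _ _) fun s hs => ?_
    have hs1 : c * (s - m) ≤ 1 := by nlinarith [hs.1, hs.2]
    have := exp_neg_le_mul_exp_neg hc hs1
    unfold poissonRatio
    rw [mul_div_mul_left _ _ hc0.ne']
    rw [show m - s = -(s - m) by ring, show c * m - c * s = -(c * (s - m)) by ring]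
    calc _ ≤ (s / m) ^ (n + 1) * (c * Real.exp (-(c * (s - m)))) := by
          have : 0 < s := by linarith [hs.1]
          gcongr
      _ = _ := by ring

lemma ThinningCondition.exists_threshold {l m : ℝ} (hm : 0 < m) (hl : m < l)
    (h : ThinningCondition l m) : ∃ k : ℕ, (∀ i ≤ k, poissonWeight l i ≤ poissonWeight m i) ∧
      ∀ j, k ≤ j → poissonCDF l (j + 1) ≤ poissonCDF m j := by
  have h1 : 1 < l / m := (one_lt_div hm).2 hl
  have hl0 : 0 < l := by linarith
  have hlog : 0 < Real.log (l / m) := Real.log_pos h1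
  have hiff : ∀ n, 1 < poissonRatio m n l ↔ l - m < n * Real.log (l / m) := fun n =>
    one_lt_poissonRatio_iff hm hl0 n
  -- The ratio at `l` exceeds 1 exactly for indices above `(l - m) / log (l / m)`.
  refine ⟨⌊(l - m) / Real.log (l / m)⌋₊, fun i hi => ?_, fun j hj => ?_⟩
  · rw [← not_lt, poissonWeight_lt_iff hm, hiff, not_lt, ← le_div_iff₀ hlog]
    exact (Nat.le_floor_iff (div_nonneg (by linarith) hlog.le)).1 hi
  · rw [poissonCDF_succ_le_iff hm]
    refine h j ((hiff _).2 ?_)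
    rw [← div_lt_iff₀ hlog]
    push_cast
    exact (Nat.lt_floor_add_one _).trans_le (by gcongr)

/-! ### Digits and fractional parts of a uniform variable -/

lemma lintegral_unitInterval (h : ℝ → ℝ≥0∞) (hh : Measurable h) :
    ∫⁻ v : I, h v = ∫⁻ t in Set.Ico (0 : ℝ) 1, h t := by
  rw [unitInterval.measurePreserving_coe.lintegral_comp hh, unitInterval,
    restrict_Ico_eq_restrict_Icc]

lemma lintegral_Ico_affine {c : ℝ} (hc : 0 < c) (a : ℝ) (h : ℝ → ℝ≥0∞) :
    ∫⁻ t in Set.Ico a (a + c), h t =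
      ENNReal.ofReal c * ∫⁻ s in Set.Ico (0 : ℝ) 1, h (a + s * c) := by
  have himg : (fun s : ℝ => a + s * c) '' Set.Ico 0 1 = Set.Ico a (a + c) := by
    ext t
    constructor
    · rintro ⟨s, ⟨h0, h1⟩, rfl⟩
      exact ⟨by nlinarith, by nlinarith⟩
    · rintro ⟨h0, h1⟩
      exact ⟨(t - a) / c, ⟨div_nonneg (by linarith) hc.le, (div_lt_one hc).2 (by linarith)⟩,
        by field_simp; ring⟩
  have hd : ∀ s ∈ Set.Ico (0 : ℝ) 1, HasDerivWithinAt (fun s : ℝ => a + s * c) c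
      (Set.Ico 0 1) s := fun s _ => by
    simpa using (((hasDerivAt_id s).mul_const c).const_add a).hasDerivWithinAt
  have hinj : Set.InjOn (fun s : ℝ => a + s * c) (Set.Ico 0 1) := fun s _ t _ h =>
    mul_right_cancel₀ hc.ne' (add_left_cancel h)
  rw [← himg, lintegral_image_eq_lintegral_abs_deriv_mul measurableSet_Ico hd hinj,
    abs_of_pos hc, lintegral_const_mul' _ _ ENNReal.ofReal_ne_top]

/-- The integer and fractional parts of `m` times a uniform variable are independent and uniform. -/
lemma lintegral_floor_fract {m : ℕ} (hm : 0 < m) (H : ℕ → ℝ → ℝ≥0∞) (hH : ∀ a, Measurable (H a)) :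
    ∫⁻ v : I, H ⌊m * (v : ℝ)⌋₊ (Int.fract (m * (v : ℝ))) =
      (m : ℝ≥0∞)⁻¹ * ∑ a ∈ Finset.range m, ∫⁻ v : I, H a v := by
  have hm' : (0 : ℝ) < m := Nat.cast_pos.2 hm
  have hmeas : Measurable fun t : ℝ => H ⌊m * t⌋₊ (Int.fract (m * t)) := by
    have h1 : Measurable fun p : ℕ × ℝ => H p.1 p.2 := measurable_from_prod_countable_right hH
    have h2 : Measurable fun t : ℝ => (⌊m * t⌋₊, Int.fract (m * t)) :=
      (Nat.measurable_floor.comp (by fun_prop)).prodMk (measurable_fract.comp (by fun_prop))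
    exact h1.comp h2
  have hu : Set.Ico (0 : ℝ) 1 = ⋃ a ∈ Finset.range m, Set.Ico ((a : ℝ) / m) ((a + 1) / m) := by
    ext t
    simp only [Set.mem_iUnion, exists_prop, Finset.mem_range, Set.mem_Ico]
    constructor
    · rintro ⟨h0, h1⟩
      have h2 : 0 ≤ m * t := by positivity
      refine ⟨⌊m * t⌋₊, (Nat.floor_lt h2).2 (by nlinarith), ?_, ?_⟩
      · rw [div_le_iff₀ hm', mul_comm t]; exact Nat.floor_le h2
      · rw [lt_div_iff₀ hm', mul_comm t]; exact Nat.lt_floor_add_one _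
    · rintro ⟨a, ha, h0, h1⟩
      refine ⟨le_trans (by positivity) h0, h1.trans_le ?_⟩
      rw [div_le_one hm']
      exact_mod_cast ha
  have hdis : Set.PairwiseDisjoint (Finset.range m : Set ℕ)
      fun a : ℕ => Set.Ico ((a : ℝ) / m) ((a + 1) / m) := by
    have hfl : ∀ (a : ℕ) (t : ℝ), t ∈ Set.Ico ((a : ℝ) / m) ((a + 1) / m) → ⌊m * t⌋₊ = a := by
      rintro a t ⟨h0, h1⟩
      rw [div_le_iff₀ hm', mul_comm] at h0
      rw [lt_div_iff₀ hm', mul_comm] at h1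
      exact (Nat.floor_eq_iff (le_trans (by positivity) h0)).2 ⟨h0, h1⟩
    intro a _ b _ hab
    exact Set.disjoint_left.2 fun t ha hb => hab ((hfl a t ha).symm.trans (hfl b t hb))
  rw [lintegral_unitInterval (fun t => H ⌊m * t⌋₊ (Int.fract (m * t))) hmeas, hu,
    lintegral_biUnion_finset hdis fun a _ => measurableSet_Ico, Finset.mul_sum]
  refine Finset.sum_congr rfl fun a _ => ?_
  rw [lintegral_unitInterval (H a) (hH a), add_div]
  have haff := lintegral_Ico_affine (c := 1 / m) (by positivity) (a / m) fun t => H a (m * t - a)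
  rw [one_div, ENNReal.ofReal_inv_of_pos hm', ENNReal.ofReal_natCast, ← one_div] at haff
  have hs : ∀ s : ℝ, (m : ℝ) * (a / m + s * (1 / m)) - a = s := fun s => by field_simp; ring
  simp only [hs] at haff
  rw [← haff]
  refine setLIntegral_congr_fun measurableSet_Ico fun t ⟨h0, h1⟩ => ?_
  rw [div_le_iff₀ hm', mul_comm] at h0
  rw [← add_div, lt_div_iff₀ hm', mul_comm] at h1
  have hfl : ⌊m * t⌋₊ = a := (Nat.floor_eq_iff (le_trans (by positivity) h0)).2 ⟨h0, h1⟩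
  have hfl' : ⌊m * t⌋ = a := Int.floor_eq_iff.2 ⟨by exact_mod_cast h0, by exact_mod_cast h1⟩
  simp only [hfl, Int.fract, hfl', Int.cast_natCast]

/-- A point is determined by its digit and its fractional part, so fibres are countable. This makes
fractional parts of uniform points almost surely distinct. -/
lemma volume_fract_fibre {m : ℕ} (hm : 0 < m) (c : ℝ) :
    volume ((fun v : I => Int.fract (m * (v : ℝ))) ⁻¹' {c}) = 0 := by
  have hm' : (m : ℝ) ≠ 0 := (Nat.cast_pos.2 hm).ne'
  refine Set.Countable.measure_zero ?_ _
  refine Set.countable_of_injective_of_countable_image (f := fun v : I => ⌊m * (v : ℝ)⌋) ?_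
    (Set.to_countable _)
  intro v hv w hw hvw
  have h1 : Int.fract (m * (v : ℝ)) = Int.fract (m * (w : ℝ)) := hv.trans hw.symm
  have h2 := Int.floor_add_fract (m * (v : ℝ))
  rw [h1, show ⌊m * (v : ℝ)⌋ = ⌊m * (w : ℝ)⌋ from hvw, Int.floor_add_fract] at h2
  exact Subtype.ext (mul_left_cancel₀ hm' h2.symm)

/-! ### Deterministic removal of one point -/

namespace SimplePointMeasure

/-- Simple point measures as a kernel. -/
noncomputable def kernel : Kernel SimplePointMeasure I := ⟨toMeasure, measurable_toMeasure⟩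

lemma kernel_apply (ν : SimplePointMeasure) : kernel ν = ν.toMeasure := rfl

instance : IsSFiniteKernel kernel where
  tsum_finite := by
    classical
    refine ⟨fun n => Kernel.piecewise (measurableSet_cardSet n) kernel 0, fun n => ?_, ?_⟩
    · refine ⟨⟨n, ENNReal.natCast_lt_top n, fun ν => ?_⟩⟩
      by_cases h : ν ∈ cardSet n
      · rw [Kernel.piecewise_apply, if_pos h, kernel_apply, toMeasure_univ]
        exact_mod_cast (show ν.pts.card = n from h).le
      · simp [Kernel.piecewise_apply, h]
    · ext ν A hA
      rw [Kernel.sum_apply' _ _ hA, tsum_eq_single ν.pts.card]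
      · rw [Kernel.piecewise_apply, if_pos (show ν ∈ cardSet ν.pts.card from rfl)]
      · intro n hn
        rw [Kernel.piecewise_apply, if_neg (c := ν ∈ cardSet n)
          fun h => hn (show ν.pts.card = n from h).symm]
        simp

/-- A sum over the points is an integral against an s-finite kernel, so no measurable enumeration of
the points is required. -/
lemma measurable_sum_pts {α : Type*} [MeasurableSpace α] {N : α → SimplePointMeasure}
    (hN : Measurable N) {g : α → I → ℝ≥0∞} (hg : Measurable fun p : α × I => g p.1 p.2) :
    Measurable fun a => ∑ y ∈ (N a).pts, g a y := by
  have := Measurable.lintegral_kernel_prod_right (κ := kernel.comap N hN) (f := g) hg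
  simpa only [Kernel.comap_apply, kernel_apply, lintegral_toMeasure] using this

lemma measurable_sum_pts_nat {α : Type*} [MeasurableSpace α] {N : α → SimplePointMeasure}
    (hN : Measurable N) {g : α → I → ℕ} (hg : Measurable fun p : α × I => g p.1 p.2) :
    Measurable fun a => ∑ y ∈ (N a).pts, g a y := by
  have h := measurable_sum_pts hN (g := fun a y => (g a y : ℝ≥0∞)) (measurable_from_top.comp hg)
  refine measurable_to_countable' fun n => ?_
  have : (fun a => ∑ y ∈ (N a).pts, g a y) ⁻¹' {n} =
      (fun a => ∑ y ∈ (N a).pts, (g a y : ℝ≥0∞)) ⁻¹' {(n : ℝ≥0∞)} := by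
    ext a
    simp only [Set.mem_preimage, Set.mem_singleton_iff]
    exact_mod_cast Iff.rfl
  rw [this]
  exact h (measurableSet_singleton _)

/-- The fractional part of a coordinate, rescaled by the number of points. -/
noncomputable def frac (ν : SimplePointMeasure) (x : I) : ℝ := Int.fract (ν.pts.card * (x : ℝ))

/-- The number of points with a smaller fractional part. -/
noncomputable def rank (ν : SimplePointMeasure) (x : I) : ℕ :=
  ∑ y ∈ ν.pts, if ν.frac y < ν.frac x then 1 else 0

/-- The sum of the leading digits of the points, in base the number of points. -/
noncomputable def digitSum (ν : SimplePointMeasure) : ℕ :=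
  ∑ y ∈ ν.pts, ⌊ν.pts.card * (y : ℝ)⌋₊

/-- The condition that selects a point for removal: its rank by fractional part is congruent to
the sum of the leading digits. -/
def IsSelected (ν : SimplePointMeasure) (x : I) : Prop :=
  ν.rank x ≡ ν.digitSum [MOD ν.pts.card]

open scoped Classical in
/-- The configuration without the selected point. -/
noncomputable def remove (ν : SimplePointMeasure) : SimplePointMeasure :=
  ofFinset (ν.pts.filter fun x => ¬ ν.IsSelected x)

open scoped Classical in
/-- The rescaled fractional part of the selected point. -/
noncomputable def mark (ν : SimplePointMeasure) : ℝ :=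
  (∑ y ∈ ν.pts, if ν.IsSelected y then ENNReal.ofReal (ν.frac y) else 0).toReal

lemma measurable_frac : Measurable fun p : SimplePointMeasure × I => p.1.frac p.2 := by
  have h1 : Measurable fun p : SimplePointMeasure × I => (p.1.pts.card : ℝ) :=
    (measurable_from_top (f := fun n : ℕ => (n : ℝ))).comp (measurable_card.comp measurable_fst)
  exact measurable_fract.comp (h1.mul (by fun_prop))

lemma measurable_rank : Measurable fun p : SimplePointMeasure × I => p.1.rank p.2 := by
  refine measurable_sum_pts_nat (α := SimplePointMeasure × I) measurable_fst
    (g := fun p y => if p.1.frac y < p.1.frac p.2 then 1 else 0) ?_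
  refine Measurable.ite (measurableSet_lt ?_ ?_) measurable_const measurable_const
  · exact measurable_frac.comp ((measurable_fst.comp measurable_fst).prodMk measurable_snd)
  · exact measurable_frac.comp measurable_fst

lemma measurable_digitSum : Measurable digitSum := by
  refine measurable_sum_pts_nat measurable_id (g := fun ν y => ⌊ν.pts.card * (y : ℝ)⌋₊) ?_
  have h1 : Measurable fun p : SimplePointMeasure × I => (p.1.pts.card : ℝ) :=
    (measurable_from_top (f := fun n : ℕ => (n : ℝ))).comp (measurable_card.comp measurable_fst)
  exact Nat.measurable_floor.comp (h1.mul (by fun_prop))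

lemma measurableSet_isSelected :
    MeasurableSet {p : SimplePointMeasure × I | p.1.IsSelected p.2} := by
  have h : Measurable fun p : SimplePointMeasure × I =>
      (p.1.rank p.2, p.1.digitSum, p.1.pts.card) :=
    measurable_rank.prodMk ((measurable_digitSum.comp measurable_fst).prodMk
      (measurable_card.comp measurable_fst))
  exact h (.of_discrete (s := {q : ℕ × ℕ × ℕ | q.1 ≡ q.2.1 [MOD q.2.2]}))

lemma measurable_mark : Measurable mark := by
  classical
  refine ENNReal.measurable_toReal.comp (measurable_sum_pts measurable_id
    (g := fun ν y => if ν.IsSelected y then ENNReal.ofReal (ν.frac y) else 0) ?_)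
  exact Measurable.ite measurableSet_isSelected measurable_frac.ennreal_ofReal measurable_const

lemma measurable_remove : Measurable remove := by
  classical
  refine measurable_of_eval fun A hA => ?_
  have : (fun ν => ν.remove.toMeasure A) = fun ν : SimplePointMeasure =>
      ∑ y ∈ ν.pts, if ¬ ν.IsSelected y ∧ y ∈ A then (1 : ℝ≥0∞) else 0 := by
    ext ν
    simp [toMeasure_apply, remove, Finset.filter_filter]
  rw [this]
  refine measurable_sum_pts measurable_id
    (g := fun ν y => if ¬ ν.IsSelected y ∧ y ∈ A then (1 : ℝ≥0∞) else 0) ?_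
  exact Measurable.ite (measurableSet_isSelected.compl.inter (measurable_snd hA))
    measurable_const measurable_const

lemma pts_remove_subset (ν : SimplePointMeasure) : ν.remove.pts ⊆ ν.pts := by
  classical
  rw [remove, pts_ofFinset]
  exact Finset.filter_subset _ _

end SimplePointMeasure

/-- The ranks of `n` distinct numbers form a complete residue system modulo `n`. -/
lemma existsUnique_rank_modEq {n : ℕ} (hn : 0 < n) {φ : Fin n → ℝ} (hφ : Function.Injective φ)
    (D : ℕ) : ∃! i, (∑ j, if φ j < φ i then 1 else 0) ≡ D [MOD n] := by
  set r : Fin n → ℕ := fun i => ∑ j, if φ j < φ i then 1 else 0 with hr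
  have hcard : ∀ i, r i = (Finset.univ.filter fun j => φ j < φ i).card := fun i => by
    simp [hr]
  have hlt : ∀ i, r i < n := fun i => by
    rw [hcard]
    conv_rhs => rw [← Finset.card_fin n]
    exact Finset.card_lt_card (Finset.filter_ssubset.2 ⟨i, Finset.mem_univ _, lt_irrefl _⟩)
  have hmono : ∀ i j, φ i < φ j → r i < r j := fun i j hij => by
    rw [hcard, hcard]
    refine Finset.card_lt_card ((Finset.ssubset_iff_of_subset fun k hk => ?_).2
      ⟨i, by simpa using hij, by simp⟩)
    simp only [Finset.mem_filter, Finset.mem_univ, true_and] at hk ⊢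
    exact hk.trans hij
  have hinj : Function.Injective r := fun i j hij => by
    by_contra hne
    rcases lt_or_gt_of_ne (hφ.ne hne) with h | h
    · exact (hmono i j h).ne hij
    · exact (hmono j i h).ne hij.symm
  have hsurj : Function.Surjective fun i => (⟨r i, hlt i⟩ : Fin n) :=
    Finite.surjective_of_injective fun i j h => hinj (Fin.mk.inj_iff.1 h)
  obtain ⟨i, hi⟩ := hsurj ⟨D % n, Nat.mod_lt _ hn⟩
  have hi' : r i = D % n := Fin.mk.inj_iff.1 hi
  refine ⟨i, ?_, fun j hj => hinj ?_⟩
  · change r i ≡ D [MOD n]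
    rw [hi']; exact Nat.mod_modEq _ _
  · rw [hi']
    exact (Nat.mod_eq_of_lt (hlt j)).symm.trans hj

/-! ### The removed point yields an independent uniform mark -/

namespace SimplePointMeasure

variable {n : ℕ}

/-- The fractional part of `(n + 1) v`. -/
noncomputable def fr (n : ℕ) (v : I) : ℝ := Int.fract (((n + 1 : ℕ) : ℝ) * (v : ℝ))

/-- The selection condition in terms of tuples. -/
def TupleSelected (x : Fin (n + 1) → I) (i : Fin (n + 1)) : Prop :=
  (∑ j, if fr n (x j) < fr n (x i) then 1 else 0) ≡
    ∑ j, ⌊((n + 1 : ℕ) : ℝ) * (x j : ℝ)⌋₊ [MOD n + 1]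

lemma frac_conf {x : Fin (n + 1) → I} (hx : Function.Injective x) (y : I) :
    (conf x).frac y = fr n y := by
  rw [frac, card_conf hx, fr]

lemma isSelected_conf {x : Fin (n + 1) → I} (hx : Function.Injective x) (i : Fin (n + 1)) :
    (conf x).IsSelected (x i) ↔ TupleSelected x i := by
  rw [IsSelected, TupleSelected, rank, digitSum, card_conf hx, sum_pts_conf hx, sum_pts_conf hx]
  simp_rw [frac_conf hx]

lemma injective_of_fr {x : Fin (n + 1) → I} (hx : Function.Injective fun i => fr n (x i)) :
    Function.Injective x := fun _ _ h => hx (congrArg (fr n) h)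

lemma existsUnique_tupleSelected {x : Fin (n + 1) → I}
    (hx : Function.Injective fun i => fr n (x i)) : ∃! i, TupleSelected x i :=
  existsUnique_rank_modEq n.succ_pos hx _

lemma mark_conf {x : Fin (n + 1) → I} (hx : Function.Injective fun i => fr n (x i))
    {i : Fin (n + 1)} (hi : TupleSelected x i) : (conf x).mark = fr n (x i) := by
  classical
  have hxi := injective_of_fr hx
  rw [mark, sum_pts_conf hxi, Finset.sum_eq_single i]
  · rw [if_pos ((isSelected_conf hxi i).2 hi), frac_conf hxi]
    exact ENNReal.toReal_ofReal (Int.fract_nonneg _)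
  · intro j _ hj
    exact if_neg fun h => hj ((existsUnique_tupleSelected hx).unique
      ((isSelected_conf hxi j).1 h) hi)
  · simp

lemma remove_conf {x : Fin (n + 1) → I} (hx : Function.Injective fun i => fr n (x i))
    {i : Fin (n + 1)} (hi : TupleSelected x i) : (conf x).remove = conf (i.removeNth x) := by
  classical
  have hxi := injective_of_fr hx
  have hri : Function.Injective (i.removeNth x) := hxi.comp Fin.succAbove_right_injective
  refine pts_injective (Finset.ext fun y => ?_)
  rw [remove, pts_ofFinset, pts_conf hri, Finset.mem_filter, pts_conf hxi]
  simp only [Finset.mem_image, Finset.mem_univ, true_and]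
  constructor
  · rintro ⟨⟨j, rfl⟩, hj⟩
    rw [isSelected_conf hxi] at hj
    obtain ⟨k, rfl⟩ := Fin.exists_succAbove_eq (show j ≠ i from fun h => hj (h ▸ hi))
    exact ⟨k, rfl⟩
  · rintro ⟨k, rfl⟩
    refine ⟨⟨i.succAbove k, rfl⟩, fun h => Fin.succAbove_ne i k ?_⟩
    exact (existsUnique_tupleSelected hx).unique ((isSelected_conf hxi _).1 h) hi

lemma ae_fr_injective (n : ℕ) :
    ∀ᵐ x : Fin (n + 1) → I, Function.Injective fun i => fr n (x i) :=
  ae_comp_injective (measurable_fract.comp (by fun_prop)) (volume_fract_fibre n.succ_pos) (n + 1)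

/-- The rank of a number among the fractional parts of a tuple. -/
noncomputable def rankIn (w : Fin n → I) (t : ℝ) : ℕ := ∑ k, if fr n (w k) < t then 1 else 0

/-- The sum of the leading digits of a tuple. -/
noncomputable def digits (w : Fin n → I) : ℕ := ∑ k, ⌊((n + 1 : ℕ) : ℝ) * (w k : ℝ)⌋₊

/-- A point does not count in its own rank, so its leading digit enters only as a summand on the
right. This isolates that digit from its fractional part and from the other points. -/
lemma tupleSelected_iff (x : Fin (n + 1) → I) (i : Fin (n + 1)) :
    TupleSelected x i ↔ rankIn (i.removeNth x) (fr n (x i)) ≡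
      ⌊((n + 1 : ℕ) : ℝ) * (x i : ℝ)⌋₊ + digits (i.removeNth x) [MOD n + 1] := by
  rw [TupleSelected, Fin.sum_univ_succAbove _ i, Fin.sum_univ_succAbove _ i, if_neg (lt_irrefl _),
    zero_add]
  rfl

lemma measurable_fr (n : ℕ) : Measurable (fr n) := measurable_fract.comp (by fun_prop)

lemma measurable_rankIn : Measurable fun p : (Fin n → I) × ℝ => rankIn p.1 p.2 :=
  Finset.measurable_sum _ fun k _ => Measurable.ite (measurableSet_lt
    ((measurable_fr n).comp ((measurable_pi_apply k).comp measurable_fst)) measurable_snd)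
    measurable_const measurable_const

lemma measurable_digits : Measurable (digits : (Fin n → I) → ℕ) :=
  Finset.measurable_sum _ fun k _ => Nat.measurable_floor.comp (by fun_prop)

/-- Exactly one digit in a complete residue system satisfies the congruence. -/
lemma sum_ite_modEq {m : ℕ} (hm : 0 < m) (b c : ℕ) (y : ℝ≥0∞) :
    ∑ a ∈ Finset.range m, (if b ≡ a + c [MOD m] then y else 0) = y := by
  have : NeZero m := ⟨hm.ne'⟩
  set a₀ := ((b : ZMod m) - c).val
  have h0 : b ≡ a₀ + c [MOD m] := by
    rw [← ZMod.natCast_eq_natCast_iff]; simp [a₀]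
  have hlt : a₀ < m := ZMod.val_lt _
  rw [Finset.sum_eq_single a₀]
  · exact if_pos h0
  · intro a ha hne
    refine if_neg fun h => hne ?_
    exact Nat.ModEq.eq_of_lt_of_lt (Nat.ModEq.add_right_cancel' c (h.symm.trans h0))
      (Finset.mem_range.1 ha) hlt
  · intro h; exact absurd (Finset.mem_range.2 hlt) h

/-- Removing the selected point of `n + 1` uniform points leaves `n` uniform points and an
independent uniform mark. -/
lemma lintegral_mark_remove (n : ℕ) {g : ℝ × SimplePointMeasure → ℝ≥0∞} (hg : Measurable g) :
    ∫⁻ ν, g (ν.mark, ν.remove) ∂unifLaw (n + 1) =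
      ∫⁻ v : I, ∫⁻ η, g ((v : ℝ), η) ∂unifLaw n := by
  classical
  set H : I × (Fin n → I) → ℝ≥0∞ := fun p =>
    if rankIn p.2 (fr n p.1) ≡ ⌊((n + 1 : ℕ) : ℝ) * (p.1 : ℝ)⌋₊ + digits p.2 [MOD n + 1]
    then g (fr n p.1, conf p.2) else 0 with hH
  have hHm : Measurable H := by
    refine Measurable.ite ?_ (hg.comp (((measurable_fr n).comp measurable_fst).prodMk
      ((measurable_conf n).comp measurable_snd))) measurable_const
    have : Measurable fun p : I × (Fin n → I) => (rankIn p.2 (fr n p.1),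
        ⌊((n + 1 : ℕ) : ℝ) * (p.1 : ℝ)⌋₊ + digits p.2) :=
      (measurable_rankIn.comp (measurable_snd.prodMk ((measurable_fr n).comp measurable_fst))).prodMk
        ((Nat.measurable_floor.comp (by fun_prop)).add (measurable_digits.comp measurable_snd))
    exact this (.of_discrete (s := {q : ℕ × ℕ | q.1 ≡ q.2 [MOD n + 1]}))
  -- Almost surely exactly one point is selected, so the integrand is a sum over the candidates for
  -- it.
  have hae : ∀ᵐ x : Fin (n + 1) → I, g ((conf x).mark, (conf x).remove) =
      ∑ i, H (x i, i.removeNth x) := by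
    filter_upwards [ae_fr_injective n] with x hx
    obtain ⟨i, hi, hu⟩ := existsUnique_tupleSelected hx
    rw [mark_conf hx hi, remove_conf hx hi, Finset.sum_eq_single i]
    · exact (if_pos ((tupleSelected_iff x i).1 hi)).symm
    · intro j _ hj
      exact if_neg fun h => hj (hu j ((tupleSelected_iff x j).2 h))
    · simp
  have hpres : ∀ i : Fin (n + 1), ∫⁻ x : Fin (n + 1) → I, H (x i, i.removeNth x) =
      ∫⁻ p, H p ∂(volume : Measure (I × (Fin n → I))) := fun i =>
    (volume_preserving_piFinSuccAbove (fun _ : Fin (n + 1) => I) i).lintegral_comp hHm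
  -- With the other points and the fractional part fixed, exactly one of the `n + 1` equally likely
  -- digits causes selection. The factor `1 / (n + 1)` cancels against the number of candidates.
  have hinner : ∀ w : Fin n → I, ∫⁻ v : I, H (v, w) =
      ((n + 1 : ℕ) : ℝ≥0∞)⁻¹ * ∫⁻ v : I, g ((v : ℝ), conf w) := by
    intro w
    have hm : ∀ a : ℕ, Measurable fun t : ℝ =>
        if rankIn w t ≡ a + digits w [MOD n + 1] then g (t, conf w) else 0 := by
      intro a
      refine Measurable.ite ?_ (hg.comp (by fun_prop)) measurable_const
      exact (measurable_rankIn.comp (measurable_prodMk_left (x := w)))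
        (.of_discrete (s := {q : ℕ | q ≡ a + digits w [MOD n + 1]}))
    have := lintegral_floor_fract n.succ_pos (fun a t =>
      if rankIn w t ≡ a + digits w [MOD n + 1] then g (t, conf w) else 0) hm
    refine this.trans ?_
    have hsum := lintegral_finsetSum (μ := (volume : Measure I)) (Finset.range (n + 1))
      fun a _ => (hm a).comp measurable_subtype_coe
    simp only [Function.comp_apply] at hsum
    rw [Nat.succ_eq_add_one, ← hsum]
    simp_rw [sum_ite_modEq n.succ_pos]
  have hgm : Measurable fun ν : SimplePointMeasure => g (ν.mark, ν.remove) :=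
    hg.comp (measurable_mark.prodMk measurable_remove)
  have hn0 : ((n + 1 : ℕ) : ℝ≥0∞) ≠ 0 := by simp
  have hg1 : ∀ v : I, Measurable fun η => g ((v : ℝ), η) := fun v => hg.comp measurable_prodMk_left
  have hg2 : Measurable fun p : I × (Fin n → I) => g ((p.1 : ℝ), conf p.2) :=
    hg.comp ((measurable_subtype_coe.comp measurable_fst).prodMk
      ((measurable_conf n).comp measurable_snd))
  rw [lintegral_unifLaw _ hgm, lintegral_congr_ae hae, lintegral_finsetSum]
  · simp_rw [hpres, lintegral_unifLaw n (hg1 _)]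
    rw [Finset.sum_const, Finset.card_fin, Measure.volume_eq_prod, lintegral_prod_symm' _ hHm]
    simp_rw [hinner]
    rw [lintegral_const_mul' _ _ (by simp), nsmul_eq_mul, ← mul_assoc,
      ENNReal.mul_inv_cancel hn0 (by simp), one_mul]
    exact (lintegral_lintegral_swap hg2.aemeasurable).symm
  · intro i _
    exact hHm.comp ((volume_preserving_piFinSuccAbove (fun _ : Fin (n + 1) => I) i).measurable)

end SimplePointMeasure

/-! ### Quantile coupling for the number of points kept -/

lemma lintegral_Ico_eq_tsum {a : ℕ → ℝ} (ha : Monotone a) {L : ℝ}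
    (hL : Filter.Tendsto a Filter.atTop (nhds L)) (h : ℝ → ℝ≥0∞) :
    ∫⁻ w in Set.Ico (a 0) L, h w = ∑' n, ∫⁻ w in Set.Ico (a n) (a (n + 1)), h w := by
  have hu : Set.Ico (a 0) L = ⋃ n, Set.Ico (a n) (a (n + 1)) := by
    ext w
    simp only [Set.mem_iUnion]
    constructor
    · rintro ⟨h0, h1⟩
      have hex : ∃ n, w < a (n + 1) :=
        ((hL.comp (Filter.tendsto_add_atTop_nat 1)).eventually (lt_mem_nhds h1)).exists
      classical
      refine ⟨Nat.find hex, ?_, Nat.find_spec hex⟩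
      rcases hn : Nat.find hex with _ | n
      · exact h0
      · exact not_lt.1 (Nat.find_min hex (m := n) (by omega))
    · rintro ⟨n, h0, h1⟩
      exact ⟨(ha n.zero_le).trans h0, h1.trans_le (ha.ge_of_tendsto hL _)⟩
  rw [hu]
  exact lintegral_iUnion (fun _ => measurableSet_Ico) ha.pairwise_disjoint_on_Ico_succ h

/-- The Poisson distribution function, excluding the endpoint. -/
noncomputable def poissonPartial (r : ℝ) (n : ℕ) : ℝ := ∑ i ∈ Finset.range n, poissonWeight r i

lemma poissonPartial_succ (r : ℝ) (n : ℕ) :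
    poissonPartial r (n + 1) = poissonPartial r n + poissonWeight r n :=
  Finset.sum_range_succ _ _

lemma poissonPartial_monotone (r : ℝ≥0) : Monotone (poissonPartial r) :=
  monotone_nat_of_le_succ fun n => by
    rw [poissonPartial_succ]; linarith [poissonWeight_nonneg r n]

lemma tendsto_poissonPartial (r : ℝ≥0) :
    Filter.Tendsto (poissonPartial r) Filter.atTop (nhds 1) :=
  (hasSum_one_poissonMeasure r).tendsto_sum_nat

/-- The distribution function of the number of points to keep, when this is not all of them. -/
noncomputable def residualCDF (l m : ℝ) (k j : ℕ) : ℝ :=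
  poissonPartial m j + (poissonPartial l (k + 1) - poissonPartial l (min j (k + 1)))

lemma residualCDF_zero (l m : ℝ) (k : ℕ) : residualCDF l m k 0 = poissonPartial l (k + 1) := by
  simp [residualCDF, poissonPartial]

/-- The increment is the mass still owed to `j` once configurations of at most `k` points are kept
whole. Starting from `poissonPartial l (k + 1)`, these increments exhaust the remaining interval up
to 1. -/
lemma residualCDF_succ_sub (l m : ℝ) (k j : ℕ) : residualCDF l m k (j + 1) - residualCDF l m k j =
    poissonWeight m j - if j ≤ k then poissonWeight l j else 0 := by
  unfold residualCDF
  split_ifs with h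
  · rw [min_eq_left (by omega), min_eq_left (by omega), poissonPartial_succ m j,
      poissonPartial_succ l j]
    ring
  · rw [min_eq_right (by omega), min_eq_right (by omega), poissonPartial_succ m j]
    ring

lemma residualCDF_of_lt (l m : ℝ) {k j : ℕ} (h : k < j) :
    residualCDF l m k j = poissonPartial m j := by
  rw [residualCDF, min_eq_right (by omega), sub_self, add_zero]

lemma residualCDF_monotone {l m : ℝ≥0} {k : ℕ}
    (h : ∀ i ≤ k, poissonWeight l i ≤ poissonWeight m i) : Monotone (residualCDF l m k) :=
  monotone_nat_of_le_succ fun j => by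
    rw [← sub_nonneg, residualCDF_succ_sub]
    split_ifs with hj
    · exact sub_nonneg.2 (h j hj)
    · rw [sub_zero]; exact poissonWeight_nonneg m j

lemma tendsto_residualCDF (l m : ℝ≥0) (k : ℕ) :
    Filter.Tendsto (residualCDF l m k) Filter.atTop (nhds 1) :=
  (tendsto_poissonPartial m).congr' (by
    filter_upwards [Filter.eventually_gt_atTop k] with j hj using (residualCDF_of_lt _ _ hj).symm)

/-- The alternative `1 ≤ w` serves only to make the quantile defined for every real. -/
lemma exists_lt_residualCDF (l m : ℝ≥0) (k : ℕ) (w : ℝ) :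
    ∃ j, w < residualCDF l m k (j + 1) ∨ 1 ≤ w := by
  rcases lt_or_ge w 1 with h | h
  · obtain ⟨j, hj⟩ := (((tendsto_residualCDF l m k).comp
      (Filter.tendsto_add_atTop_nat 1)).eventually (lt_mem_nhds h)).exists
    exact ⟨j, .inl hj⟩
  · exact ⟨0, .inr h⟩

open scoped Classical in
/-- The quantile function of `residualCDF`. -/
noncomputable def residualQuantile (l m : ℝ≥0) (k : ℕ) (w : ℝ) : ℕ :=
  Nat.find (exists_lt_residualCDF l m k w)

lemma measurable_residualQuantile (l m : ℝ≥0) (k : ℕ) : Measurable (residualQuantile l m k) := by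
  classical
  refine measurable_find (p := fun w j => w < residualCDF l m k (j + 1) ∨ 1 ≤ w)
    (exists_lt_residualCDF l m k) fun j => ?_
  exact measurableSet_Iio.union measurableSet_Ici

lemma residualQuantile_le {l m : ℝ≥0} {k j : ℕ} {w : ℝ} (h : w < residualCDF l m k (j + 1)) :
    residualQuantile l m k w ≤ j := by
  classical
  exact Nat.find_min' _ (.inl h)

lemma residualQuantile_eq {l m : ℝ≥0} {k j : ℕ} {w : ℝ}
    (hle : ∀ i ≤ k, poissonWeight l i ≤ poissonWeight m i)
    (h0 : residualCDF l m k j ≤ w) (h1 : w < residualCDF l m k (j + 1)) :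
    residualQuantile l m k w = j := by
  classical
  have hmono := residualCDF_monotone hle
  refine (Nat.find_eq_iff _).2 ⟨.inl h1, fun i hi h => ?_⟩
  rcases h with h | h
  · exact not_lt.2 ((hmono hi).trans h0) h
  · exact not_lt.2 (hmono.ge_of_tendsto (tendsto_residualCDF l m k) _) (h.trans_lt h1)

/-! ### The thinning and its law -/

namespace SimplePointMeasure

lemma measurable_remove_iterate (j : ℕ) : Measurable (remove^[j]) := measurable_remove.iterate j

lemma pts_remove_iterate_subset (j : ℕ) (ν : SimplePointMeasure) :
    (remove^[j] ν).pts ⊆ ν.pts := by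
  induction j with
  | zero => exact subset_rfl
  | succ j ih =>
    rw [Function.iterate_succ_apply']
    exact (pts_remove_subset _).trans ih

lemma lintegral_remove_iterate (j n : ℕ) {g : SimplePointMeasure → ℝ≥0∞} (hg : Measurable g) :
    ∫⁻ ν, g (remove^[j] ν) ∂unifLaw (n + j) = ∫⁻ ν, g ν ∂unifLaw n := by
  induction j with
  | zero => rfl
  | succ j ih =>
    have := lintegral_mark_remove (n + j) (g := fun p => g (remove^[j] p.2))
      (hg.comp ((measurable_remove_iterate j).comp measurable_snd))
    simp_rw [Function.iterate_succ_apply, ← add_assoc]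
    rw [this]
    simp only [ih]
    simp

/-- The position, in the unit interval, that determines how many points are kept. -/
noncomputable def position (l : ℝ) (ν : SimplePointMeasure) : ℝ :=
  poissonPartial l ν.pts.card + ν.mark * poissonWeight l ν.pts.card

lemma measurable_position (l : ℝ) : Measurable (position l) := by
  have h1 : ∀ φ : ℕ → ℝ, Measurable fun ν : SimplePointMeasure => φ ν.pts.card := fun φ =>
    measurable_from_top.comp measurable_card
  exact (h1 _).add (measurable_mark.mul (h1 _))

open scoped Classical in
/-- The thinning that keeps everything if there are at most `k` points, and otherwise uses the mark
of the first point removed in order to decide how many points to keep. -/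
noncomputable def thin (l m : ℝ≥0) (k : ℕ) (ν : SimplePointMeasure) : SimplePointMeasure :=
  if ν.pts.card ≤ k then ν
  -- One removal has already taken place, to expose the mark; the remaining ones bring the number of
  -- points down to the quantile.
  else remove^[ν.pts.card - 1 - residualQuantile l m k (position l ν)] ν.remove

lemma pts_thin_subset (l m : ℝ≥0) (k : ℕ) (ν : SimplePointMeasure) :
    (thin l m k ν).pts ⊆ ν.pts := by
  unfold thin
  split_ifs
  · exact subset_rfl
  · exact (pts_remove_iterate_subset _ _).trans (pts_remove_subset ν)

lemma measurable_iterate_uncurry :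
    Measurable fun p : ℕ × SimplePointMeasure => remove^[p.1] p.2 :=
  measurable_from_prod_countable_right measurable_remove_iterate

lemma measurable_thin (l m : ℝ≥0) (k : ℕ) : Measurable (thin l m k) := by
  classical
  refine Measurable.ite (measurable_card (.of_discrete (s := {i | i ≤ k}))) measurable_id ?_
  refine measurable_iterate_uncurry.comp (Measurable.prodMk ?_ measurable_remove)
  exact (measurable_card.sub_const 1).sub
    ((measurable_residualQuantile l m k).comp (measurable_position l))

variable {l m : ℝ≥0} {k : ℕ}

lemma lintegral_thin_of_le {n : ℕ} (hn : n ≤ k) (g : SimplePointMeasure → ℝ≥0∞) :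
    ∫⁻ ν, g (thin l m k ν) ∂unifLaw n = ∫⁻ ν, g ν ∂unifLaw n := by
  refine lintegral_congr_ae ?_
  filter_upwards [ae_unifLaw_card n] with ν hν
  rw [thin, if_pos (by omega)]

/-- Given `n` points, the position is uniform on the block of length `poissonWeight l n` and
independent of what the first removal leaves; later removals preserve uniformity of the points. -/
lemma lintegral_thin_of_lt (hl : 0 < l)
    (hF : ∀ j, k ≤ j → poissonCDF l (j + 1) ≤ poissonCDF m j) {n : ℕ} (hn : k < n)
    {g : SimplePointMeasure → ℝ≥0∞} (hg : Measurable g) :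
    ENNReal.ofReal (poissonWeight l n) * ∫⁻ ν, g (thin l m k ν) ∂unifLaw n =
      ∫⁻ w in Set.Ico (poissonPartial l n) (poissonPartial l (n + 1)),
        ∫⁻ ν, g ν ∂unifLaw (residualQuantile l m k w) := by
  obtain ⟨n, rfl⟩ : ∃ n', n = n' + 1 := ⟨n - 1, by omega⟩
  set pos : ℝ → ℝ := fun v => poissonPartial l (n + 1) + v * poissonWeight l (n + 1) with hpos
  have hposm : Measurable pos := by fun_prop
  set G : ℝ × SimplePointMeasure → ℝ≥0∞ := fun p =>
    g (remove^[n - residualQuantile l m k (pos p.1)] p.2)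
  have hG : Measurable G := by
    refine hg.comp (measurable_iterate_uncurry.comp (Measurable.prodMk ?_ measurable_snd))
    exact measurable_const.sub
      ((measurable_residualQuantile l m k).comp (hposm.comp measurable_fst))
  have h1 : ∫⁻ ν, g (thin l m k ν) ∂unifLaw (n + 1) =
      ∫⁻ ν, G (ν.mark, ν.remove) ∂unifLaw (n + 1) := by
    refine lintegral_congr_ae ?_
    filter_upwards [ae_unifLaw_card (n + 1)] with ν hν
    rw [thin, if_neg (by omega), position, hν]
    rfl
  rw [h1, lintegral_mark_remove n hG,
    lintegral_unitInterval (fun v => ∫⁻ η, G (v, η) ∂unifLaw n) hG.lintegral_prod_right',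
    poissonPartial_succ l (n + 1), lintegral_Ico_affine (poissonWeight_pos (NNReal.coe_pos.2 hl) _)]
  congr 1
  refine setLIntegral_congr_fun measurableSet_Ico fun v hv => ?_
  -- The quantile never asks for more than the `n` points that remain: the position lies below
  -- `poissonCDF l (n + 1)`, hence below `poissonCDF m n`.
  have hq : residualQuantile l m k (pos v) ≤ n := by
    refine residualQuantile_le ?_
    rw [residualCDF_of_lt _ _ hn]
    refine lt_of_lt_of_le ?_ (hF n (by omega))
    have : poissonCDF l (n + 1) = poissonPartial l (n + 1) + poissonWeight l (n + 1) :=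
      poissonPartial_succ _ _
    rw [this]
    have := poissonWeight_pos (NNReal.coe_pos.2 hl) (n + 1)
    have := hv.2
    simp only [hpos]
    nlinarith
  have := lintegral_remove_iterate (n - residualQuantile l m k (pos v))
    (residualQuantile l m k (pos v)) hg
  rwa [Nat.add_sub_cancel' hq] at this

lemma lintegral_poissonLaw (r : ℝ≥0) (g : SimplePointMeasure → ℝ≥0∞) :
    ∫⁻ ν, g ν ∂poissonLaw r =
      ∑' n, ENNReal.ofReal (poissonWeight r n) * ∫⁻ ν, g ν ∂unifLaw n := by
  simp_rw [poissonLaw, lintegral_sum_measure, lintegral_smul_measure, poissonMeasure_singleton_eq,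
    smul_eq_mul]

lemma lintegral_residualQuantile (hle : ∀ i ≤ k, poissonWeight l i ≤ poissonWeight m i)
    (U : ℕ → ℝ≥0∞) :
    ∫⁻ w in Set.Ico (poissonPartial l (k + 1)) 1, U (residualQuantile l m k w) =
      ∑' j, ENNReal.ofReal (poissonWeight m j - if j ≤ k then poissonWeight l j else 0) * U j := by
  rw [← residualCDF_zero l m k, lintegral_Ico_eq_tsum (residualCDF_monotone hle)
    (tendsto_residualCDF l m k)]
  refine tsum_congr fun j => ?_
  rw [← residualCDF_succ_sub, setLIntegral_congr_fun (g := fun _ => U j) measurableSet_Ico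
    fun w hw => by dsimp only; rw [residualQuantile_eq hle hw.1 hw.2]]
  rw [setLIntegral_const, Real.volume_Ico, mul_comm]

lemma map_thin_poissonLaw (hl : 0 < l) (hle : ∀ i ≤ k, poissonWeight l i ≤ poissonWeight m i)
    (hF : ∀ j, k ≤ j → poissonCDF l (j + 1) ≤ poissonCDF m j) :
    (poissonLaw l).map (thin l m k) = poissonLaw m := by
  refine Measure.ext_of_lintegral _ fun g hg => ?_
  rw [lintegral_map hg (measurable_thin l m k), lintegral_poissonLaw, lintegral_poissonLaw]
  set U : ℕ → ℝ≥0∞ := fun n => ∫⁻ ν, g ν ∂unifLaw n with hU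
  rw [← Summable.sum_add_tsum_nat_add' (k := k + 1) ENNReal.summable]
  -- The blocks for more than `k` points tile `[poissonPartial l (k + 1), 1)`.
  have htail : ∑' n, ENNReal.ofReal (poissonWeight l (n + (k + 1))) *
      ∫⁻ ν, g (thin l m k ν) ∂unifLaw (n + (k + 1)) =
      ∫⁻ w in Set.Ico (poissonPartial l (k + 1)) 1, U (residualQuantile l m k w) := by
    have hmono : Monotone fun n => poissonPartial l (n + (k + 1)) :=
      (poissonPartial_monotone l).comp fun a b h => Nat.add_le_add_right h _
    have := lintegral_Ico_eq_tsum hmono ((tendsto_poissonPartial l).comp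
      (Filter.tendsto_add_atTop_nat (k + 1))) fun w => U (residualQuantile l m k w)
    rw [zero_add] at this
    rw [this]
    refine tsum_congr fun n => ?_
    rw [lintegral_thin_of_lt hl hF (by omega) hg, add_right_comm]
  have hhead : ∑ n ∈ Finset.range (k + 1), ENNReal.ofReal (poissonWeight l n) *
      ∫⁻ ν, g (thin l m k ν) ∂unifLaw n =
      ∑' n, ENNReal.ofReal (if n ≤ k then poissonWeight l n else 0) * U n := by
    rw [tsum_eq_sum (s := Finset.range (k + 1))]
    · refine Finset.sum_congr rfl fun n hn => ?_
      have hn' : n ≤ k := by simpa [Nat.lt_succ_iff] using hn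
      rw [if_pos hn', lintegral_thin_of_le hn']
    · intro n hn
      rw [if_neg (by simpa using hn), ENNReal.ofReal_zero, zero_mul]
  rw [htail, hhead, lintegral_residualQuantile hle, ← ENNReal.tsum_add]
  refine tsum_congr fun n => ?_
  rw [← add_mul]
  congr 1
  -- The mass kept whole and the residual mass add up to the target weight.
  split_ifs with hn
  · rw [← ENNReal.ofReal_add (poissonWeight_nonneg l n) (sub_nonneg.2 (hle n hn)),
      add_sub_cancel]
  · simp

end SimplePointMeasure

/-! ### Existence and the two monotonicity statements -/

open SimplePointMeasure

lemma exists_isThinning {lam mu : ℝ≥0} (hmu : 0 < mu) (hlt : mu < lam)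
    (h : ThinningCondition lam mu) : ∃ f, IsThinning lam mu f := by
  obtain ⟨k, hle, hF⟩ := h.exists_threshold (NNReal.coe_pos.2 hmu) (NNReal.coe_lt_coe.2 hlt)
  exact ⟨thin lam mu k, (isThinning_iff (measurable_thin lam mu k)).2
    ⟨map_thin_poissonLaw (hmu.trans hlt) hle hF, .of_forall (pts_thin_subset lam mu k)⟩⟩

theorem mainTheorem4 (lam mu : ℝ≥0) (hmu : 0 < mu) (hlt : mu < lam)
    (h : ∃ f, IsThinning lam mu f) :
    (∀ lam' : ℝ≥0, lam < lam' → ∃ f, IsThinning lam' mu f) ∧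
    (∀ lam' mu' : ℝ≥0, mu' / lam' = mu / lam → lam < lam' → ∃ f, IsThinning lam' mu' f) := by
  obtain ⟨f, hf⟩ := h
  have hc := hf.thinningCondition hmu
  have hmu' : (0 : ℝ) < mu := NNReal.coe_pos.2 hmu
  have hlt' : (mu : ℝ) < lam := NNReal.coe_lt_coe.2 hlt
  have hlam : 0 < lam := hmu.trans hlt
  refine ⟨fun lam' hl => exists_isThinning hmu (hlt.trans hl)
    (hc.mono hmu' hlt' (NNReal.coe_le_coe.2 hl.le)), fun lam' mu' hr hl => ?_⟩
  -- Equal ratios mean that both intensities are multiplied by the same `c ≥ 1`.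
  set c := lam' / lam
  have hlam' : lam' = c * lam := (div_mul_cancel₀ _ hlam.ne').symm
  have hmu'' : mu' = c * mu := by
    rw [(div_eq_iff (hlam.trans hl).ne').1 hr]
    simp only [c]
    ring
  have h1c : 1 ≤ c := (one_le_div₀ hlam).2 hl.le
  have hc0 : 0 < c := one_pos.trans_le h1c
  rw [hlam', hmu'']
  refine exists_isThinning (mul_pos hc0 hmu) (mul_lt_mul_of_pos_left hlt hc0) ?_
  push_cast
  exact hc.scale hmu' hlt' (by exact_mod_cast h1c)
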